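/- Let $\Gamma=(V,E)$ be a finite simple graph and $n\ge 1$. Let $\mathcal D^n(\Gamma)$ be the combinatorial configuration space of $n$ indistinguishable particles: its $0$-cells are the $n$-element subsets of $V$; its directed $1$-cells are the moves $\{v_1,\dots,v_{n-1},i\to j\}$, where $i\sim j$ and $v_1,\dots,v_{n-1},i,j$ are distinct vertices; its $2$-cells are the squares in which two particles move along disjoint edges $i\leftrightarrow k$, $j\leftrightarrow l$ while the other $n-2$ particles stay at vertices different from $i,j,k,l$. An $n$-particle gauge potential is a function $\Omega^{(n)}$ on directed $1$-cells with values in $\mathbb R/2\pi\mathbb Z$ that changes sign when the direction is reversed; its flux through an oriented cycle (closed edge path) is the sum of its values along the cycle. Two gauge potentials are equivalent if they have the same flux through every oriented cycle, and $\Omega^{(n)}$ is topological if its flux through every oriented cycle that is contractible in $\mathcal D^n(\Gamma)$ is $0$. A $1$-particle gauge potential $\omega$ describes the pure Aharonov–Bohm potential $\Omega_{AB}(\{p,j\to k\})=\omega(j\to k)$, and a $2$-particle gauge potential $\Omega_S$ is a pure statistics potential if $\sum_{p\neq j,k}\Omega_S(\{p,j\to k\})=0$ for every directed edge $j\to k$.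 A splitting of $\Omega^{(2)}$ is a pair $(\omega^{(1)},\Omega^{(2)}_S)$ with $\Omega^{(2)}=\Omega_{AB}^{(2)}+\Omega_S^{(2)}$, where $\Omega_{AB}^{(2)}$ is the pure Aharonov–Bohm potential described by $\omega^{(1)}$ and $\Omega^{(2)}_S$ is a pure statistics potential. 1. Every $2$-particle gauge potential has a real-valued antisymmetric representative $R$; and for every such $R$, reduction modulo $2\pi$ of $$\omega(j\to k)=\frac1{|V|-2}\sum_{p\ne j,k}R(\{p,j\to k\}),\qquad R_S(\{i,j\to k\})=R(\{i,j\to k\})-\omega(j\to k)$$ gives a splitting (where $|V|=2$ the sums are empty and $\omega=0$). 2. If $\Omega^{(2)}$ is topological and $(\omega^{(1)},\Omega_S^{(2)})$ is any splitting of it, then $\Omega_{AB}^{(2)}$ and $\Omega_S^{(2)}$ are topological, and $$\Omega^{(n)}(\{v_1,\dots,v_{n-1},i\to j\})=\omega^{(1)}(i\to j)+\sum_{r=1}^{n-1}\Omega_S^{(2)}(\{v_r,i\to j\})$$ defines a topological $n$-particle gauge potential. 3. Suppose that $\Gamma$ is $2$-connected ($|V|>2$ and $\Gamma\setminus X$ is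 connected for every $X\subset V$ with $|X|<2$) and sufficiently subdivided for $n$ particles (every path between distinct vertices of valence $\neq 2$ has at least $n-1$ edges, and every cycle has at least $n+1$ edges). Then every topological $n$-particle gauge potential is equivalent to one of the form in 2, where $\Omega^{(2)}$ is a topological $2$-particle gauge potential and the splitting is obtained as in 1 from a real representative of $\Omega^{(2)}$. -/

import Mathlib

noncomputable section

namespace GraphConf

variable {V : Type*}

/-- A finite simple graph is `k`-connected if it has more than `k` vertices and stays connected
after the removal of any set of fewer than `k` vertices. -/
def IsKConnected [Fintype V] (k : ℕ) (G : SimpleGraph V) : Prop :=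
  k < Fintype.card V ∧ ∀ X : Finset V, X.card < k → (G.induce {v | v ∉ X}).Connected

/-- Sufficiently subdivided for `n` particles: every path between distinct vertices of valence
not equal to two passes through at least `n - 1` edges, and every cycle passes through at least
`n + 1` edges. -/
def IsSufficientlySubdivided (G : SimpleGraph V) (n : ℕ) : Prop :=
  (∀ (u v : V) (p : G.Walk u v), u ≠ v → (G.neighborSet u).ncard ≠ 2 →
    (G.neighborSet v).ncard ≠ 2 → p.IsPath → n ≤ p.length + 1) ∧
  (∀ (u : V) (p : G.Walk u u), p.IsCycle → n + 1 ≤ p.length)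

/-- The `0`-cells of the combinatorial configuration space `𝒟ⁿ(Γ)`: sets of `n` vertices. -/
@[ext]
structure Config (G : SimpleGraph V) (n : ℕ) where
  verts : Finset V
  card_verts : verts.card = n

/-- The directed `1`-cells `{v₁, …, vₙ₋₁, i → j}` of `𝒟ⁿ(Γ)`: `stay = {v₁, …, vₙ₋₁}`, and
`i = src`, `j = tgt` are the ends of an edge of `Γ`, neither of which is in `stay`. -/
@[ext]
structure Move (G : SimpleGraph V) (n : ℕ) where
  stay : Finset V
  src : V
  tgt : V
  adj : G.Adj src tgt
  src_notMem : src ∉ stay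
  tgt_notMem : tgt ∉ stay
  card_stay : stay.card + 1 = n

/-- The `2`-cells of `𝒟ⁿ(Γ)`, with a choice of orientation and of a corner: two particles move
along the disjoint edges `i ↔ k` and `j ↔ l`, the other `n - 2` particles stay on vertices
different from `i, j, k, l`. -/
structure Square (G : SimpleGraph V) (n : ℕ) where
  stay : Finset V
  i : V
  k : V
  j : V
  l : V
  adj_ik : G.Adj i k
  adj_jl : G.Adj j l
  ne_ij : i ≠ j
  ne_il : i ≠ l
  ne_kj : k ≠ j
  ne_kl : k ≠ l
  i_notMem : i ∉ stay
  k_notMem : k ∉ stay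
  j_notMem : j ∉ stay
  l_notMem : l ∉ stay
  card_stay : stay.card + 2 = n

variable {G : SimpleGraph V} {n : ℕ}

namespace Move

/-- The same edge, directed oppositely. -/
def reverse (e : Move G n) : Move G n where
  stay := e.stay
  src := e.tgt
  tgt := e.src
  adj := e.adj.symm
  src_notMem := e.tgt_notMem
  tgt_notMem := e.src_notMem
  card_stay := e.card_stay

/-- The underlying one-particle move `i → j`, a directed edge of `Γ = 𝒟¹(Γ)`. -/
def single (e : Move G n) : Move G 1 where
  stay := ∅
  src := e.src
  tgt := e.tgt
  adj := e.adj
  src_notMem := by simp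
  tgt_notMem := by simp
  card_stay := by simp

/-- The two-particle move `{p, i → j}`, where `i → j` is the underlying one-particle move. -/
def pair (e : Move G n) (p : V) (hi : p ≠ e.src) (hj : p ≠ e.tgt) : Move G 2 where
  stay := {p}
  src := e.src
  tgt := e.tgt
  adj := e.adj
  src_notMem := by simpa using hi.symm
  tgt_notMem := by simpa using hj.symm
  card_stay := by simp

variable [DecidableEq V]

/-- The configuration before the move. -/
def source (e : Move G n) : Config G n where
  verts := insert e.src e.stay
  card_verts := by rw [Finset.card_insert_of_notMem e.src_notMem, e.card_stay]

/-- The configuration after the move. -/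
def target (e : Move G n) : Config G n where
  verts := insert e.tgt e.stay
  card_verts := by rw [Finset.card_insert_of_notMem e.tgt_notMem, e.card_stay]

end Move

section Paths

variable [DecidableEq V]

/-- The `1`-skeleton of `𝒟ⁿ(Γ)`: an arrow is a directed `1`-cell, so that `Quiver.Path S T` is
the type of edge paths from `S` to `T`, and an oriented cycle is a `Quiver.Path S S`. -/
instance instQuiverConfig : Quiver (Config G n) where
  Hom S T := {e : Move G n // e.source = S ∧ e.target = T}

/-- A directed `1`-cell as an arrow of the `1`-skeleton. -/
def Move.hom (e : Move G n) {S T : Config G n} (hS : e.source = S) (hT : e.target = T) :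
    S ⟶ T :=
  ⟨e, hS, hT⟩

/-- The opposite arrow. -/
def homReverse {S T : Config G n} (a : S ⟶ T) : T ⟶ S :=
  a.1.reverse.hom a.2.2 a.2.1

namespace Square

/-- The four sides of a square, in the cyclic order
`{i, j → l}`, `{l, i → k}`, `{k, l → j}`, `{j, k → i}`. -/
def side₁ (c : Square G n) : Move G n where
  stay := insert c.i c.stay
  src := c.j
  tgt := c.l
  adj := c.adj_jl
  src_notMem := by simp [c.ne_ij.symm, c.j_notMem]
  tgt_notMem := by simp [c.ne_il.symm, c.l_notMem]
  card_stay := by rw [Finset.card_insert_of_notMem c.i_notMem]; exact c.card_stay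

def side₂ (c : Square G n) : Move G n where
  stay := insert c.l c.stay
  src := c.i
  tgt := c.k
  adj := c.adj_ik
  src_notMem := by simp [c.ne_il, c.i_notMem]
  tgt_notMem := by simp [c.ne_kl, c.k_notMem]
  card_stay := by rw [Finset.card_insert_of_notMem c.l_notMem]; exact c.card_stay

def side₃ (c : Square G n) : Move G n where
  stay := insert c.k c.stay
  src := c.l
  tgt := c.j
  adj := c.adj_jl.symm
  src_notMem := by simp [c.ne_kl.symm, c.l_notMem]
  tgt_notMem := by simp [c.ne_kj.symm, c.j_notMem]
  card_stay := by rw [Finset.card_insert_of_notMem c.k_notMem]; exact c.card_stay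

def side₄ (c : Square G n) : Move G n where
  stay := insert c.j c.stay
  src := c.k
  tgt := c.i
  adj := c.adj_ik.symm
  src_notMem := by simp [c.ne_kj, c.k_notMem]
  tgt_notMem := by simp [c.ne_ij, c.i_notMem]
  card_stay := by rw [Finset.card_insert_of_notMem c.j_notMem]; exact c.card_stay

/-- The closed edge path of length four around the boundary of a `2`-cell. -/
def boundary (c : Square G n) : Quiver.Path c.side₁.source c.side₁.source :=
  (((Quiver.Path.nil.cons (c.side₁.hom rfl rfl)).cons
    (c.side₂.hom (T := c.side₂.target)
      (Config.ext (Finset.insert_comm c.i c.l c.stay)) rfl)).cons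
    (c.side₃.hom (T := c.side₃.target)
      (Config.ext (Finset.insert_comm c.l c.k c.stay)) rfl)).cons
    (c.side₄.hom
      (Config.ext (Finset.insert_comm c.k c.j c.stay))
      (Config.ext (Finset.insert_comm c.i c.j c.stay)))

end Square

/-- Homotopy of edge paths (with fixed ends) in the cell complex `𝒟ⁿ(Γ)`: the congruence
generated by the removal of backtracks and of boundaries of `2`-cells. -/
inductive PathHomotopic :
    ∀ {S T : Config G n}, Quiver.Path S T → Quiver.Path S T → Prop
  | refl {S T : Config G n} (p : Quiver.Path S T) : PathHomotopic p p
  | symm {S T : Config G n} {p q : Quiver.Path S T} :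
      PathHomotopic p q → PathHomotopic q p
  | trans {S T : Config G n} {p q r : Quiver.Path S T} :
      PathHomotopic p q → PathHomotopic q r → PathHomotopic p r
  | comp {S T U : Config G n} {p p' : Quiver.Path S T} {q q' : Quiver.Path T U} :
      PathHomotopic p p' → PathHomotopic q q' → PathHomotopic (p.comp q) (p'.comp q')
  | backtrack {S T : Config G n} (a : S ⟶ T) :
      PathHomotopic ((Quiver.Path.nil.cons a).cons (homReverse a)) Quiver.Path.nil
  | square (c : Square G n) : PathHomotopic c.boundary Quiver.Path.nil

/-- An oriented cycle is contractible if it is homotopic to a constant path. -/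
def IsContractible {S : Config G n} (C : Quiver.Path S S) : Prop :=
  PathHomotopic C Quiver.Path.nil

end Paths

/-- The group of `n`-particle gauge potentials with values in the abelian group `A`: functions on
the directed `1`-cells of `𝒟ⁿ(Γ)` that change sign when the direction is reversed.  The gauge
potentials proper are those with values in `Real.Angle`, the reals modulo `2π`. -/
def GaugePotential (G : SimpleGraph V) (n : ℕ) (A : Type*) [AddCommGroup A] :
    AddSubgroup (Move G n → A) where
  carrier := {Ω | ∀ e : Move G n, Ω e.reverse = -Ω e}
  add_mem' {Ω Ω'} h h' e := by simp only [Pi.add_apply, h e, h' e]; abel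
  zero_mem' e := by simp
  neg_mem' {Ω} h e := by simp only [Pi.neg_apply, h e]

section Values

variable {A : Type*} [AddCommGroup A]

/-- The flux of a gauge potential through an edge path: the sum of its values. -/
def flux [DecidableEq V] (Ω : GaugePotential G n A) {S T : Config G n}
    (p : Quiver.Path S T) : A :=
  p.addWeight (fun {S T : Config G n} (a : S ⟶ T) => Ω.1 a.1)

/-- Two gauge potentials are equivalent if they have the same flux through every oriented
cycle. -/
def Equivalent [DecidableEq V] (Ω Ω' : GaugePotential G n A) : Prop :=
  ∀ (S : Config G n) (C : Quiver.Path S S), flux Ω C = flux Ω' C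

/-- A gauge potential is topological if its flux through every contractible oriented cycle
vanishes. -/
def IsTopological [DecidableEq V] (Ω : GaugePotential G n A) : Prop :=
  ∀ (S : Config G n) (C : Quiver.Path S S), IsContractible C → flux Ω C = 0

/-- The pure Aharonov-Bohm two-particle potential `{p, i → j} ↦ ω(i → j)` described by the
one-particle potential `ω`. -/
def pureAB (ω : GaugePotential G 1 A) : GaugePotential G 2 A :=
  ⟨fun e => ω.1 e.single, fun e => ω.2 e.single⟩

/-- A two-particle potential is a pure statistics potential if, for each one-particle move
`j → k`, its values on `{p, j → k}` sum to zero over all positions `p ≠ j, k`. -/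
def IsPureStatistics [Fintype V] [DecidableEq V] (S : GaugePotential G 2 A) : Prop :=
  ∀ e : Move G 1, ∑ p : {p : V // p ≠ e.src ∧ p ≠ e.tgt}, S.1 (e.pair p.1 p.2.1 p.2.2) = 0

/-- `Ω` is split into the pure Aharonov-Bohm part described by `ω` and the pure statistics
part `S`. -/
structure IsSplitting [Fintype V] [DecidableEq V] (Ω : GaugePotential G 2 A)
    (ω : GaugePotential G 1 A) (S : GaugePotential G 2 A) : Prop where
  eq_add : Ω = pureAB ω + S
  pureStatistics : IsPureStatistics S

/-- The `n`-particle potential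
`{v₁, …, vₙ₋₁, i → j} ↦ ω(i → j) + ∑ r, S({v_r, i → j})`. -/
def nParticle (n : ℕ) (ω : GaugePotential G 1 A) (S : GaugePotential G 2 A) :
    GaugePotential G n A :=
  ⟨fun e => ω.1 e.single + ∑ v : {v : V // v ∈ e.stay},
      S.1 (e.pair v.1 (ne_of_mem_of_not_mem v.2 e.src_notMem)
        (ne_of_mem_of_not_mem v.2 e.tgt_notMem)),
    fun e => by
      rw [neg_add, ← Finset.sum_neg_distrib]
      exact congrArg₂ (· + ·) (ω.2 e.single) (Finset.sum_congr rfl fun v _ =>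
        S.2 (e.pair v.1 (ne_of_mem_of_not_mem v.2 e.src_notMem)
          (ne_of_mem_of_not_mem v.2 e.tgt_notMem)))⟩

end Values

/-- Reduction of a real-valued gauge potential modulo `2π`. -/
def modTwoPi (R : GaugePotential G n ℝ) : GaugePotential G n Real.Angle :=
  ⟨fun e => ((R.1 e : ℝ) : Real.Angle), fun e => by
    change ((R.1 e.reverse : ℝ) : Real.Angle) = -((R.1 e : ℝ) : Real.Angle)
    rw [R.2 e, Real.Angle.coe_neg]⟩

section Average

variable [Fintype V] [DecidableEq V]

/-- The one-particle potential `ω(j → k) = (1 / (|V| - 2)) ∑_{p ≠ j, k} R({p, j → k})`. -/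
def average (R : GaugePotential G 2 ℝ) : GaugePotential G 1 ℝ :=
  ⟨fun e => 1 / ((Fintype.card V : ℝ) - 2) *
      ∑ p : {p : V // p ≠ e.src ∧ p ≠ e.tgt}, R.1 (e.pair p.1 p.2.1 p.2.2),
    fun e => by
      have h : ∑ p : {p : V // p ≠ e.reverse.src ∧ p ≠ e.reverse.tgt},
            R.1 (e.reverse.pair p.1 p.2.1 p.2.2)
          = ∑ p : {p : V // p ≠ e.src ∧ p ≠ e.tgt}, -R.1 (e.pair p.1 p.2.1 p.2.2) :=
        Fintype.sum_equiv (Equiv.subtypeEquivRight fun p => and_comm) _ _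
          fun p => R.2 (e.pair p.1 p.2.2 p.2.1)
      refine (congrArg (fun x => 1 / ((Fintype.card V : ℝ) - 2) * x) h).trans ?_
      simp only [Finset.sum_neg_distrib, mul_neg]⟩

/-- The pure statistics part `R - R_AB`, where `R_AB` is described by the average of `R`. -/
def statisticsPart (R : GaugePotential G 2 ℝ) : GaugePotential G 2 ℝ :=
  R - pureAB (average R)

end Average

end GraphConf

end

/-! Parts 1 and 2 are direct. Averaging is done over the reals, where division by `|V| - 2` makes
sense. A potential is topological exactly when its flux around every square vanishes
(`isTopological_iff`). For `nParticle` the spectators contribute oppositely to opposite sides of a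
square, and what remains is a square of the two-particle potential.

For part 3, write the potential as a closed cochain `F`, with `F X u w` its value on `{X, u → w}`.
The basic invariants are the fluxes of two-particle exchanges on stars. If all of them vanish on a
connected graph, `F` is a one-particle potential plus a coboundary
(`GrowsTo.exists_isCohomologousOn`). It therefore suffices to find a closed two-particle cochain `T`
with the same star fluxes as `F`. The spectators cancel in the star fluxes of `pairSum T`, so `F -
pairSum T` has none, and `F` is equivalent to a one-particle potential plus pair interactions.

To construct `T` for `n ≥ 3`, park `n - 2` particles on the interior of a path with `n - 1` edges
that starts at a vertex with at least three neighbours. Its interior vertices have valence two. A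
two-particle move that misses the interior gets the value of `F` with the parked particles added. A
spectator on the interior pushes a parked particle out at an end of the path. For this to be
consistent it must not matter which end is used; a gauge in which slides along the path have zero
flux ensures that (`exists_slideFlux_eq_zero`, `isClosedPair_parkedPair`). The star fluxes of `T`
agree with those of `F` because the latter do not depend on the positions of the spectators
(`IsClosedOn.starFlux_eq`): removing a star leaves a subdivided 2-connected graph connected.

Finally, real lifts are taken and the average of the pair interaction is absorbed into the
one-particle part (`exists_nParticle_average_eq`). -/

namespace GraphConf

/-! ### Cochains, star fluxes, and displacing one of several indistinguishable particles -/

variable {V : Type*} {A : Type*} [AddCommGroup A] {G : SimpleGraph V}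

/-- Sequences of weighted steps, with their total weight. -/
inductive WeightedReach (St : V → V → A → Prop) : V → V → A → Prop
  | refl (a : V) : WeightedReach St a a 0
  | head {a c b : V} {t s : A} :
      St a c t → WeightedReach St c b s → WeightedReach St a b (t + s)

theorem WeightedReach.tail {St : V → V → A → Prop} {a b c : V} {s t : A}
    (h : WeightedReach St a b s) (hbc : St b c t) : WeightedReach St a c (s + t) := by
  induction h with
  | refl a => simpa using WeightedReach.head hbc (.refl _)
  | head hac _ ih => rw [add_assoc]; exact .head hac (ih hbc)

variable [DecidableEq V]

/-- A function on all triples `(X, u, w)` whose values on the directed `1`-cells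
`{X, u → w}` with vertices in `W` form a closed `n`-particle cochain. -/
structure IsClosedOn (G : SimpleGraph V) (W : Finset V) (n : ℕ)
    (F : Finset V → V → V → A) : Prop where
  antisymm : ∀ X u w, F X w u = -F X u w
  square : ∀ (X : Finset V) (i k j l : V), X ⊆ W → i ∈ W → k ∈ W → j ∈ W → l ∈ W →
    G.Adj i k → G.Adj j l → i ≠ j → i ≠ l → k ≠ j → k ≠ l →
    i ∉ X → k ∉ X → j ∉ X → l ∉ X → X.card + 2 = n →
    F (insert i X) j l + F (insert l X) i k = F (insert k X) j l + F (insert j X) i k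

/-- The flux through the exchange of two particles on the star with centre `v` and leaves
`i, j, k`, the other particles staying on `M`. -/
def starFlux (F : Finset V → V → V → A) (M : Finset V) (v i j k : V) : A :=
  F (insert i M) j v + F (insert i M) v k + (F (insert k M) i v + F (insert k M) v j) +
    (F (insert j M) k v + F (insert j M) v i)

/-- All exchanges of two particles on a star in `W` have zero flux. -/
def StarFluxZeroOn (G : SimpleGraph V) (W : Finset V) (n : ℕ)
    (F : Finset V → V → V → A) : Prop :=
  ∀ (M : Finset V) (v i j k : V), M ⊆ W → v ∈ W → i ∈ W → j ∈ W → k ∈ W →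
    G.Adj v i → G.Adj v j → G.Adj v k → i ≠ j → j ≠ k → i ≠ k →
    v ∉ M → i ∉ M → j ∉ M → k ∉ M → M.card + 2 = n → starFlux F M v i j k = 0

/-- On `1`-cells with vertices in `W`, the cochain `F` is a one-particle potential plus a
coboundary. -/
def IsCohomologousOn (G : SimpleGraph V) (W : Finset V) (n : ℕ) (F : Finset V → V → V → A)
    (α : V → V → A) (f : Finset V → A) : Prop :=
  ∀ (X : Finset V) (u w : V), X ⊆ W → u ∈ W → w ∈ W → G.Adj u w → u ∉ X → w ∉ X →
    X.card + 1 = n → F X u w = α u w + f (insert w X) - f (insert u X)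

section Tokens

/-- A function on configurations that does not change when one particle makes an elementary
step does not change when one particle is displaced arbitrarily. -/
theorem eq_of_reflTransGen {B : Type*} {U : Finset V} {m : ℕ} {g : Finset V → B}
    {R : V → V → Prop}
    (hR : ∀ a c, R a c → a ≠ c ∧ a ∈ U ∧ c ∈ U ∧ ∀ X ⊆ U, X.card = m → a ∉ X → c ∉ X →
      g (insert a X) = g (insert c X)) {a b : V} (hab : Relation.ReflTransGen R a b)
    (hb : b ∈ U) :
    a ∈ U ∧ ∀ X ⊆ U, X.card = m → a ∉ X → b ∉ X → g (insert a X) = g (insert b X) := by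
  induction hab using Relation.ReflTransGen.head_induction_on with
  | refl => exact ⟨hb, fun _ _ _ _ _ => rfl⟩
  | @head a c hac _ ih =>
    obtain ⟨hne, ha, hc, hstep⟩ := hR a c hac
    refine ⟨ha, fun X hX hcard haX hbX => ?_⟩
    by_cases hab : a = b
    · rw [hab]
    -- If `c` is occupied, the particle there first goes on to `b`, and the one at `a` then steps to
    -- the vacated `c`. As the particles are indistinguishable, this has the same effect as moving
    -- `a` to `b`.
    by_cases hcX : c ∈ X
    · have hcb : c ≠ b := fun h => hbX (h ▸ hcX)
      have hZ : X.erase c ⊆ U := (Finset.erase_subset _ _).trans hX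
      have hcd : (X.erase c).card + 1 = m := by rw [Finset.card_erase_add_one hcX, hcard]
      have haZ : a ∉ X.erase c := fun h => haX (Finset.mem_of_mem_erase h)
      have hbZ : b ∉ X.erase c := fun h => hbX (Finset.mem_of_mem_erase h)
      have h1 := ih.2 (insert a (X.erase c)) (Finset.insert_subset ha hZ)
        (by rw [Finset.card_insert_of_notMem haZ, hcd])
        (by simp [hne.symm]) (by simp [Ne.symm hab, hbX])
      have h2 := hstep (insert b (X.erase c)) (Finset.insert_subset hb hZ)
        (by rw [Finset.card_insert_of_notMem hbZ, hcd])
        (by simp [hab, haX]) (by simp [hcb])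
      rw [Finset.insert_comm, Finset.insert_erase hcX] at h1
      rw [h1, Finset.insert_comm, h2, Finset.insert_comm, Finset.insert_erase hcX]
    · exact (hstep X hX hcard haX hcX).trans (ih.2 X hX hcard hcX hbX)

/-- Configurations of indistinguishable particles on a connected graph are connected. -/
theorem eq_of_card_eq {B : Type*} {U : Finset V} {m : ℕ} {g : Finset V → B}
    {R : V → V → Prop}
    (hR : ∀ a c, R a c → a ≠ c ∧ a ∈ U ∧ c ∈ U ∧ ∀ X ⊆ U, X.card = m → a ∉ X → c ∉ X →
      g (insert a X) = g (insert c X))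
    (hconn : ∀ a ∈ U, ∀ b ∈ U, Relation.ReflTransGen R a b) {S S' : Finset V}
    (hS : S ⊆ U) (hS' : S' ⊆ U) (hc : S.card = m + 1) (hc' : S'.card = m + 1) :
    g S = g S' := by
  -- Each round carries a particle of `S \ S'` to a vertex of `S' \ S`.
  induction hd : (S \ S').card generalizing S with
  | zero =>
    have : S ⊆ S' := Finset.sdiff_eq_empty_iff_subset.1 (Finset.card_eq_zero.1 hd)
    rw [Finset.eq_of_subset_of_card_le this (by omega)]
  | succ d ih =>
    obtain ⟨a, ha⟩ : (S \ S').Nonempty := Finset.card_pos.1 (by omega)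
    obtain ⟨b, hb⟩ : (S' \ S).Nonempty := Finset.card_pos.1 (by
      have h1 := Finset.card_sdiff_add_card_inter S S'
      have h2 := Finset.card_sdiff_add_card_inter S' S
      rw [Finset.inter_comm] at h2
      omega)
    rw [Finset.mem_sdiff] at ha hb
    have hbE : b ∉ S.erase a := fun h => hb.2 (Finset.mem_of_mem_erase h)
    have hcE : (S.erase a).card = m := by rw [Finset.card_erase_of_mem ha.1, hc]; rfl
    have hsub : S.erase a ⊆ U := (Finset.erase_subset _ _).trans hS
    have h := (eq_of_reflTransGen hR (hconn a (hS ha.1) b (hS' hb.1)) (hS' hb.1)).2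
      (S.erase a) hsub hcE (Finset.notMem_erase _ _) hbE
    rw [Finset.insert_erase ha.1] at h
    rw [h]
    refine ih (Finset.insert_subset (hS' hb.1) hsub)
      (by rw [Finset.card_insert_of_notMem hbE, hcE]) ?_
    have : insert b (S.erase a) \ S' = (S \ S').erase a := by
      ext x
      simp only [Finset.mem_sdiff, Finset.mem_insert, Finset.mem_erase]
      constructor
      · rintro ⟨rfl | h, h'⟩
        · exact absurd hb.1 h'
        · exact ⟨h.1, h.2, h'⟩
      · rintro ⟨h1, h2, h3⟩
        exact ⟨Or.inr ⟨h1, h2⟩, h3⟩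
    rw [this, Finset.card_erase_of_mem (by simp [ha]), hd]
    rfl

/-- If each elementary step changes a function on configurations by its weight, then sequences
of steps change it by their total weight, and closed sequences have weight zero. -/
theorem WeightedReach.sub_eq {U : Finset V} {m : ℕ} {g : Finset V → A}
    {St : V → V → A → Prop} (hU : m + 2 ≤ U.card)
    (hSt : ∀ a c t, St a c t → a ≠ c ∧ a ∈ U ∧ c ∈ U ∧ ∀ X ⊆ U, X.card = m → a ∉ X → c ∉ X →
      g (insert a X) - g (insert c X) = t) {a b : V} {s : A} (h : WeightedReach St a b s)
    (hb : b ∈ U) :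
    a ∈ U ∧ (a = b → s = 0) ∧ ∀ X ⊆ U, X.card = m → a ≠ b → a ∉ X → b ∉ X →
      g (insert a X) - g (insert b X) = s := by
  induction h with
  | refl a => exact ⟨hb, fun _ => rfl, fun _ _ _ h => absurd rfl h⟩
  | @head a c b t s hac _ ih =>
    obtain ⟨-, ihz, ih⟩ := ih hb
    obtain ⟨hne, ha, hc, hstep⟩ := hSt a c t hac
    refine ⟨ha, ?_, fun X hX hcard hab haX hbX => ?_⟩
    -- For a closed sequence, compare the first step `a → c` with the way back from `c` to `a`, with
    -- the same `m` spectators off `a` and `c`. The bound `m + 2 ≤ U.card` provides room for them.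
    · rintro rfl
      obtain ⟨X, hX, hXc⟩ : ∃ X ⊆ (U.erase a).erase c, X.card = m :=
        Finset.exists_subset_card_eq (by
          rw [Finset.card_erase_of_mem (Finset.mem_erase.2 ⟨hne.symm, hc⟩),
            Finset.card_erase_of_mem ha]
          omega)
      have haX : a ∉ X := fun h => by simpa using hX h
      have hcX : c ∉ X := fun h => by simpa using hX h
      have hXU : X ⊆ U :=
        hX.trans ((Finset.erase_subset _ _).trans (Finset.erase_subset _ _))
      rw [← hstep X hXU hXc haX hcX, ← ih X hXU hXc hne.symm hcX haX]
      abel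
    by_cases hcb : c = b
    · subst hcb
      rw [ihz rfl, add_zero]
      exact hstep X hX hcard haX hbX
    by_cases hcX : c ∈ X
    · have hZ : X.erase c ⊆ U := (Finset.erase_subset _ _).trans hX
      have hcd : (X.erase c).card + 1 = m := by rw [Finset.card_erase_add_one hcX, hcard]
      have haZ : a ∉ X.erase c := fun h => haX (Finset.mem_of_mem_erase h)
      have hbZ : b ∉ X.erase c := fun h => hbX (Finset.mem_of_mem_erase h)
      have h1 := ih (insert a (X.erase c)) (Finset.insert_subset ha hZ)
        (by rw [Finset.card_insert_of_notMem haZ, hcd]) hcb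
        (by simp [hne.symm]) (by simp [Ne.symm hab, hbX])
      have h2 := hstep (insert b (X.erase c)) (Finset.insert_subset hb hZ)
        (by rw [Finset.card_insert_of_notMem hbZ, hcd])
        (by simp [hab, haX]) (by simp [hcb])
      rw [Finset.insert_comm c a, Finset.insert_erase hcX] at h1
      rw [Finset.insert_comm c b, Finset.insert_erase hcX, Finset.insert_comm a b] at h2
      rw [← h1, ← h2, Finset.insert_comm b a]
      abel
    · rw [← hstep X hX hcard haX hcX, ← ih X hX hcard hcb hcX hbX]
      abel

/-- Both weights are the same difference of values of `g`. This path independence is what later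
makes a difference of one-particle potentials a coboundary. -/
theorem WeightedReach.unique {U : Finset V} {m : ℕ} {g : Finset V → A}
    {St : V → V → A → Prop} (hU : m + 2 ≤ U.card)
    (hSt : ∀ a c t, St a c t → a ≠ c ∧ a ∈ U ∧ c ∈ U ∧ ∀ X ⊆ U, X.card = m → a ∉ X → c ∉ X →
      g (insert a X) - g (insert c X) = t) {a b : V} {s s' : A} (h : WeightedReach St a b s)
    (h' : WeightedReach St a b s') (hb : b ∈ U) : s = s' := by
  obtain ⟨ha, hz, hs⟩ := h.sub_eq hU hSt hb
  obtain ⟨-, hz', hs'⟩ := h'.sub_eq hU hSt hb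
  by_cases hab : a = b
  · rw [hz hab, hz' hab]
  obtain ⟨X, hX, hXc⟩ : ∃ X ⊆ (U.erase a).erase b, X.card = m :=
    Finset.exists_subset_card_eq (by
      rw [Finset.card_erase_of_mem (Finset.mem_erase.2 ⟨Ne.symm hab, hb⟩),
        Finset.card_erase_of_mem ha]
      omega)
  have haX : a ∉ X := fun h => by simpa using hX h
  have hbX : b ∉ X := fun h => by simpa using hX h
  have hXU : X ⊆ U := hX.trans ((Finset.erase_subset _ _).trans (Finset.erase_subset _ _))
  rw [← hs X hXU hXc hab haX hbX, hs' X hXU hXc hab haX hbX]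

end Tokens

end GraphConf

/-! ### Vanishing star fluxes force a one-particle potential -/

namespace GraphConf

variable {V : Type*} {A : Type*} [AddCommGroup A] {G : SimpleGraph V}

theorem WeightedReach.reflTransGen {St : V → V → A → Prop} {a b : V} {s : A}
    (h : WeightedReach St a b s) : Relation.ReflTransGen (fun a c => ∃ t, St a c t) a b := by
  induction h with
  | refl a => exact .refl
  | head hac _ ih => exact .head ⟨_, hac⟩ ih

variable [DecidableEq V]

/-- The sets of vertices obtained from a vertex by adding neighbours one at a time. -/
inductive GrowsTo (G : SimpleGraph V) : Finset V → Prop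
  | singleton (v : V) : GrowsTo G {v}
  | grow {W : Finset V} {u z : V} :
      GrowsTo G W → z ∉ W → u ∈ W → G.Adj u z → GrowsTo G (insert z W)

theorem GrowsTo.reflTransGen {W : Finset V} (hW : GrowsTo G W) :
    ∀ a ∈ W, ∀ b ∈ W, Relation.ReflTransGen (fun a b => G.Adj a b ∧ a ∈ W ∧ b ∈ W) a b := by
  induction hW with
  | singleton v =>
    intro a ha b hb
    rw [Finset.mem_singleton.1 ha, Finset.mem_singleton.1 hb]
  | @grow W u z _ hz hu huz ih =>
    have key : ∀ a ∈ W, ∀ b ∈ W, Relation.ReflTransGen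
        (fun a b => G.Adj a b ∧ a ∈ insert z W ∧ b ∈ insert z W) a b := fun a ha b hb =>
      Relation.ReflTransGen.mono (fun _ _ h =>
        ⟨h.1, Finset.mem_insert_of_mem h.2.1, Finset.mem_insert_of_mem h.2.2⟩) _ _ (ih a ha b hb)
    have hu' := Finset.mem_insert_of_mem (b := z) hu
    have hz' := Finset.mem_insert_self z W
    intro a ha b hb
    rcases Finset.mem_insert.1 ha with rfl | haW <;> rcases Finset.mem_insert.1 hb with rfl | hbW
    · exact .refl
    · exact .head ⟨huz.symm, hz', hu'⟩ (key u hu b hbW)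
    · exact .tail (key a haW u hu) ⟨huz, hu', hz'⟩
    · exact key a haW b hbW

theorem growsTo_univ [Fintype V] (hG : G.Connected) : GrowsTo G (Finset.univ : Finset V) := by
  classical
  obtain ⟨v⟩ := hG.nonempty
  obtain ⟨W, hW, hmax⟩ := Set.Finite.exists_maximal
    (s := {W : Finset V | GrowsTo G W}) (Set.toFinite _) ⟨{v}, .singleton v⟩
  suffices W = Finset.univ by rwa [← this]
  by_contra hne
  obtain ⟨b, hb⟩ : ∃ b, b ∉ W := by
    by_contra! h
    exact hne (Finset.eq_univ_iff_forall.2 h)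
  obtain ⟨a, ha⟩ : W.Nonempty := by
    cases hW with
    | singleton v => exact ⟨v, by simp⟩
    | grow h _ _ _ => exact Finset.insert_nonempty _ _
  obtain ⟨p⟩ := hG.preconnected a b
  obtain ⟨d, -, hd1, hd2⟩ := p.exists_boundary_dart (W : Set V) ha hb
  exact hd2 (hmax (hW.grow hd2 hd1 d.adj) (Finset.subset_insert _ _)
    (Finset.mem_insert_self _ _))

/-- The steps of a particle in `W \ {u}`: along an edge, or through the vertex `u`, weighted by
a one-particle potential. -/
def HopStep (G : SimpleGraph V) (W : Finset V) (u : V) (β : V → V → A) (a b : V) (t : A) : Prop :=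
  a ≠ b ∧ a ∈ W.erase u ∧ b ∈ W.erase u ∧
    ((G.Adj a b ∧ t = β a b) ∨ (G.Adj a u ∧ G.Adj u b ∧ t = β a u + β u b))

/-- Removing `u` may disconnect `W`, but a passage `d → u → c` of a walk in `W` can be replaced by a
single hop. While the walk stands at `u`, the second clause of `key` remembers the vertex `d` it
came from. -/
theorem GrowsTo.exists_weightedReach {W : Finset V} (hW : GrowsTo G W) {u : V}
    (β : V → V → A) {a b : V} (ha : a ∈ W.erase u) (hb : b ∈ W.erase u) :
    ∃ s, WeightedReach (HopStep G W u β) a b s := by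
  have key : (b ≠ u → ∃ s, WeightedReach (HopStep G W u β) a b s) ∧
      (b = u → ∃ d ∈ W.erase u, G.Adj d u ∧
        ∃ s, WeightedReach (HopStep G W u β) a d s) := by
    have hp := hW.reflTransGen a (Finset.mem_of_mem_erase ha) b (Finset.mem_of_mem_erase hb)
    clear hb
    induction hp with
    | refl => exact ⟨fun _ => ⟨0, .refl a⟩, fun h => absurd h (Finset.ne_of_mem_erase ha)⟩
    | @tail b c _ hbc ih =>
      obtain ⟨hadj, hbW, hcW⟩ := hbc
      by_cases hb : b = u
      · obtain ⟨d, hd, hdu, s, hs⟩ := ih.2 hb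
        subst hb
        refine ⟨fun hc => ?_, fun hc => absurd hc hadj.ne'⟩
        by_cases hdc : d = c
        · exact ⟨s, hdc ▸ hs⟩
        · exact ⟨_, hs.tail ⟨hdc, hd, Finset.mem_erase.2 ⟨hc, hcW⟩, .inr ⟨hdu, hadj, rfl⟩⟩⟩
      · obtain ⟨s, hs⟩ := ih.1 hb
        have hbE := Finset.mem_erase.2 ⟨hb, hbW⟩
        refine ⟨fun hc => ⟨_, hs.tail ⟨hadj.ne, hbE, Finset.mem_erase.2 ⟨hc, hcW⟩,
          .inl ⟨hadj, rfl⟩⟩⟩, ?_⟩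
        rintro rfl
        exact ⟨b, hbE, hadj, s, hs⟩
  exact key.1 (Finset.ne_of_mem_erase hb)

section Extension

variable {W : Finset V} {z u : V} {m : ℕ} {F : Finset V → V → V → A}
  {α₁ α₂ : V → V → A} {f₁ f₂ : Finset V → A}

/-- How the value on `{X, u → z}`, corrected by the potentials on both sides, changes when one
particle of `X` makes a step. -/
theorem hopStep_sub_eq (hF : IsClosedOn G (insert z W) (m + 2) F)
    (hY : StarFluxZeroOn G (insert z W) (m + 2) F)
    (h₁ : IsCohomologousOn G W (m + 2) F α₁ f₁)
    (h₂ : IsCohomologousOn G W (m + 1) (fun X => F (insert z X)) α₂ f₂)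
    (hα₁ : ∀ a b, α₁ b a = -α₁ a b) (hz : z ∉ W) (hu : u ∈ W) (huz : G.Adj u z)
    {a b : V} {t : A} (h : HopStep G W u (α₁ - α₂) a b t) :
    a ≠ b ∧ a ∈ W.erase u ∧ b ∈ W.erase u ∧ ∀ X ⊆ W.erase u, X.card = m → a ∉ X → b ∉ X →
      (F (insert a X) u z + f₁ (insert u (insert a X)) - f₂ (insert a X)) -
        (F (insert b X) u z + f₁ (insert u (insert b X)) - f₂ (insert b X)) = t := by
  obtain ⟨hab, ha, hb, h⟩ := h
  refine ⟨hab, ha, hb, fun X hX hc haX hbX => ?_⟩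
  rw [Finset.mem_erase] at ha hb
  have huX : u ∉ X := fun h => by simpa using hX h
  have hXW : X ⊆ W := hX.trans (Finset.erase_subset _ _)
  have hzX : z ∉ X := fun h => hz (hXW h)
  have haz : a ≠ z := fun h => hz (h ▸ ha.2)
  have hbz : b ≠ z := fun h => hz (h ▸ hb.2)
  have hWz := Finset.subset_insert z W
  -- A step along an edge is governed by the square on `a b` and `u z`; a hop through `u`, by the
  -- exchange on the star at `u` with leaves `a, b, z`. In both, `h₁` evaluates the moves with `z`
  -- empty and `h₂` those with `z` occupied.
  rcases h with ⟨hadj, rfl⟩ | ⟨hau, hub, rfl⟩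
  · have hsq := hF.square X a b u z (hXW.trans hWz) (hWz ha.2) (hWz hb.2) (hWz hu)
      (Finset.mem_insert_self _ _) hadj huz ha.1 haz hb.1 hbz haX hbX huX hzX (by omega)
    have e1 := h₁ (insert u X) a b (Finset.insert_subset hu hXW) ha.2 hb.2 hadj
      (by simp [ha.1, haX]) (by simp [hb.1, hbX])
      (by rw [Finset.card_insert_of_notMem huX]; omega)
    have e2 := h₂ X a b hXW ha.2 hb.2 hadj haX hbX (by omega)
    simp only at e2
    rw [e1, e2, Finset.insert_comm b u, Finset.insert_comm a u] at hsq
    simp only [Pi.sub_apply]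
    linear_combination (norm := abel) hsq
  · have hs := hY X u a b z (hXW.trans hWz) (hWz hu) (hWz ha.2) (hWz hb.2)
      (Finset.mem_insert_self _ _) hau.symm hub huz hab hbz haz huX haX hbX hzX (by omega)
    unfold starFlux at hs
    have e1 := h₁ (insert a X) b u (Finset.insert_subset ha.2 hXW) hb.2 hu hub.symm
      (by simp [hab.symm, hbX]) (by simp [ha.1.symm, huX])
      (by rw [Finset.card_insert_of_notMem haX]; omega)
    have e1' := h₁ (insert b X) u a (Finset.insert_subset hb.2 hXW) hu ha.2 hau.symm
      (by simp [hb.1.symm, huX]) (by simp [hab, haX])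
      (by rw [Finset.card_insert_of_notMem hbX]; omega)
    have e2 := h₂ X a u hXW ha.2 hu hau haX huX (by omega)
    have e2' := h₂ X u b hXW hu hb.2 hub huX hbX (by omega)
    simp only at e2 e2'
    rw [e1, e1', e2, e2', hF.antisymm _ u z, Finset.insert_comm a b, hα₁ u b, hα₁ a u] at hs
    simp only [Pi.sub_apply]
    linear_combination (norm := abel) hs

/-- The two one-particle potentials agree on `W` up to a coboundary. -/
theorem exists_sub_eq_coboundary (hF : IsClosedOn G (insert z W) (m + 2) F)
    (hY : StarFluxZeroOn G (insert z W) (m + 2) F)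
    (h₁ : IsCohomologousOn G W (m + 2) F α₁ f₁)
    (h₂ : IsCohomologousOn G W (m + 1) (fun X => F (insert z X)) α₂ f₂)
    (hα₁ : ∀ a b, α₁ b a = -α₁ a b) (hα₂ : ∀ a b, α₂ b a = -α₂ a b)
    (hW : GrowsTo G W) (hz : z ∉ W) (hu : u ∈ W) (huz : G.Adj u z) (hm : m + 3 ≤ W.card) :
    ∃ h : V → A, ∀ a ∈ W, ∀ b ∈ W, G.Adj a b → α₁ a b - α₂ a b = h b - h a := by
  classical
  have hU : m + 2 ≤ (W.erase u).card := by rw [Finset.card_erase_of_mem hu]; omega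
  obtain ⟨a₀, ha₀⟩ : (W.erase u).Nonempty := Finset.card_pos.1 (by omega)
  have huniq : ∀ {a b : V} {s s' : A}, WeightedReach (HopStep G W u (α₁ - α₂)) a b s →
      WeightedReach (HopStep G W u (α₁ - α₂)) a b s' → b ∈ W.erase u → s = s' :=
    fun hs hs' hb => hs.unique (g := fun X => F X u z + f₁ (insert u X) - f₂ X) hU
      (fun _ _ _ h => hopStep_sub_eq hF hY h₁ h₂ hα₁ hz hu huz h) hs' hb
  have hex : ∀ b, ∃ s, b ∈ W.erase u → WeightedReach (HopStep G W u (α₁ - α₂)) a₀ b s := by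
    intro b
    by_cases hb : b ∈ W.erase u
    · obtain ⟨s, hs⟩ := hW.exists_weightedReach (α₁ - α₂) ha₀ hb
      exact ⟨s, fun _ => hs⟩
    · exact ⟨0, fun h => absurd h hb⟩
  choose h hh using hex
  have hanti : ∀ a b, (α₁ - α₂) b a = -(α₁ - α₂) a b := fun a b => by
    simp only [Pi.sub_apply, hα₁ a b, hα₂ a b]; abel
  have hedge : ∀ a ∈ W.erase u, ∀ b ∈ W.erase u, G.Adj a b →
      α₁ a b - α₂ a b = h b - h a := fun a ha b hb hab => by
    have := huniq (hh b hb) ((hh a ha).tail ⟨hab.ne, ha, hb, .inl ⟨hab, rfl⟩⟩) hb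
    rw [this]
    simp
  have hhop : ∀ a ∈ W.erase u, ∀ b ∈ W.erase u, G.Adj a u → G.Adj b u →
      h a + (α₁ - α₂) a u = h b + (α₁ - α₂) b u := fun a ha b hb hau hbu => by
    by_cases hab : a = b
    · rw [hab]
    have := huniq (hh b hb) ((hh a ha).tail ⟨hab, ha, hb, .inr ⟨hau, hbu.symm, rfl⟩⟩) hb
    rw [this, hanti b u]
    abel
  -- `c` is the value the primitive must take at `u`; by the hops it is the same from every
  -- neighbour of `u`. It is arbitrary if `u` has no neighbour in `W`.
  obtain ⟨c, hc⟩ : ∃ c, ∀ a ∈ W.erase u, G.Adj a u → h a + (α₁ - α₂) a u = c := by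
    by_cases hd : ∃ d ∈ W.erase u, G.Adj d u
    · obtain ⟨d, hd, hdu⟩ := hd
      exact ⟨_, fun a ha hau => hhop a ha d hd hau hdu⟩
    · exact ⟨0, fun a ha hau => absurd ⟨a, ha, hau⟩ hd⟩
  refine ⟨Function.update h u c, fun a ha b hb hab => ?_⟩
  by_cases hau : a = u
  · subst hau
    have hbE : b ∈ W.erase a := Finset.mem_erase.2 ⟨hab.ne', hb⟩
    have := hanti b a
    rw [Function.update_self, Function.update_of_ne hab.ne', ← hc b hbE hab.symm,
      ← Pi.sub_apply, ← Pi.sub_apply, this]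
    abel
  have haE : a ∈ W.erase u := Finset.mem_erase.2 ⟨hau, ha⟩
  by_cases hbu : b = u
  · subst hbu
    rw [Function.update_self, Function.update_of_ne hau, ← hc a haE hab]
    simp
  · rw [Function.update_of_ne hau, Function.update_of_ne hbu]
    exact hedge a haE b (Finset.mem_erase.2 ⟨hbu, hb⟩) hab

theorem exists_common_potential (hF : IsClosedOn G (insert z W) (m + 2) F)
    (hY : StarFluxZeroOn G (insert z W) (m + 2) F)
    (h₁ : IsCohomologousOn G W (m + 2) F α₁ f₁)
    (h₂ : IsCohomologousOn G W (m + 1) (fun X => F (insert z X)) α₂ f₂)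
    (hα₁ : ∀ a b, α₁ b a = -α₁ a b) (hα₂ : ∀ a b, α₂ b a = -α₂ a b)
    (hW : GrowsTo G W) (hz : z ∉ W) (hu : u ∈ W) (huz : G.Adj u z) :
    ∃ (α : V → V → A) (g₁ g₂ : Finset V → A), (∀ a b, α b a = -α a b) ∧
      IsCohomologousOn G W (m + 2) F α g₁ ∧
      IsCohomologousOn G W (m + 1) (fun X => F (insert z X)) α g₂ := by
  rcases Nat.lt_or_ge W.card (m + 3) with hm | hm
  -- A move of `m + 2` particles involves `m + 3` vertices. A smaller `W` admits none, and the first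
  -- relation is vacuous for any potential.
  · refine ⟨α₂, f₁, f₂, hα₂, fun X u w hX hu hw huw huX hwX hc => ?_, h₂⟩
    have := Finset.card_le_card (Finset.insert_subset hu (Finset.insert_subset hw hX))
    rw [Finset.card_insert_of_notMem (by simp [huw.ne, huX]),
      Finset.card_insert_of_notMem hwX] at this
    omega
  · obtain ⟨h, hh⟩ := exists_sub_eq_coboundary hF hY h₁ h₂ hα₁ hα₂ hW hz hu huz hm
    refine ⟨α₁, f₁, fun S => f₂ S - ∑ p ∈ S, h p, hα₁, h₁,
      fun X u w hX hu hw huw huX hwX hc => ?_⟩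
    have e := hh u hu w hw huw
    rw [h₂ X u w hX hu hw huw huX hwX hc]
    simp only [Finset.sum_insert huX, Finset.sum_insert hwX]
    linear_combination (norm := abel) -e

/-- With equal potentials all hop weights vanish, so the corrected value on `{X, u → z}` is
invariant under every step of a spectator, and the configurations on `W.erase u` are connected by
such steps. -/
theorem exists_value_of_common_potential (hF : IsClosedOn G (insert z W) (m + 2) F)
    (hY : StarFluxZeroOn G (insert z W) (m + 2) F)
    (h₁ : IsCohomologousOn G W (m + 2) F α₁ f₁)
    (h₂ : IsCohomologousOn G W (m + 1) (fun X => F (insert z X)) α₁ f₂)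
    (hα₁ : ∀ a b, α₁ b a = -α₁ a b)
    (hW : GrowsTo G W) (hz : z ∉ W) (hu : u ∈ W) (huz : G.Adj u z) :
    ∃ c : A, ∀ X ⊆ W, u ∉ X → X.card = m + 1 →
      F X u z + f₁ (insert u X) - f₂ X = c := by
  by_cases hex : ∃ X₀ ⊆ W.erase u, X₀.card = m + 1
  · obtain ⟨X₀, hX₀, hc₀⟩ := hex
    refine ⟨_, fun X hX huX hc => eq_of_card_eq (U := W.erase u) (m := m)
      (g := fun X => F X u z + f₁ (insert u X) - f₂ X)
      (R := fun a b => ∃ t, HopStep G W u (α₁ - α₁) a b t) ?_ ?_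
      (Finset.subset_erase.2 ⟨hX, huX⟩) hX₀ hc hc₀⟩
    · rintro a b ⟨t, hab⟩
      obtain ⟨h1, h2, h3, h4⟩ := hopStep_sub_eq hF hY h₁ h₂ hα₁ hz hu huz hab
      have ht : t = 0 := by rcases hab.2.2.2 with h | h <;> simp [h.2]
      exact ⟨h1, h2, h3, fun X hX hc haX hbX => sub_eq_zero.1 ((h4 X hX hc haX hbX).trans ht)⟩
    · intro a ha b hb
      obtain ⟨s, hs⟩ := hW.exists_weightedReach (α₁ - α₁) ha hb
      exact hs.reflTransGen
  · exact ⟨0, fun X hX huX hc => absurd ⟨X, Finset.subset_erase.2 ⟨hX, huX⟩, hc⟩ hex⟩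

end Extension

/-- On a connected graph a closed cochain with vanishing fluxes through all two-particle
exchanges on stars is cohomologous to a one-particle potential. -/
theorem GrowsTo.exists_isCohomologousOn {W : Finset V} (hW : GrowsTo G W) :
    ∀ (n : ℕ) (F : Finset V → V → V → A), IsClosedOn G W n F → StarFluxZeroOn G W n F →
      ∃ (α : V → V → A) (f : Finset V → A), (∀ a b, α b a = -α a b) ∧
        IsCohomologousOn G W n F α f := by
  induction hW with
  | singleton v =>
    refine fun n F _ _ => ⟨0, 0, by simp, fun X u w _ hu hw huw _ _ _ => ?_⟩
    rw [Finset.mem_singleton.1 hu, Finset.mem_singleton.1 hw] at huw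
    exact absurd rfl huw.ne
  | @grow W u₀ z hW hz hu₀ hu₀z ih =>
    intro n F hF hY
    have hWz := Finset.subset_insert z W
    -- Without particles there are no moves, and for one particle `F ∅` itself is the potential.
    obtain _ | _ | m := n
    · exact ⟨0, 0, by simp, fun X u w _ _ _ _ _ _ hc => by omega⟩
    · refine ⟨F ∅, 0, hF.antisymm ∅, fun X u w _ _ _ _ _ _ hc => ?_⟩
      rw [Finset.card_eq_zero.1 (by omega : X.card = 0)]
      simp
    have hF₁ : IsClosedOn G W (m + 2) F := ⟨hF.antisymm, fun X i k j l hX hi hk hj hl =>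
      hF.square X i k j l (hX.trans hWz) (hWz hi) (hWz hk) (hWz hj) (hWz hl)⟩
    have hY₁ : StarFluxZeroOn G W (m + 2) F := fun M v i j k hM hv hi hj hk =>
      hY M v i j k (hM.trans hWz) (hWz hv) (hWz hi) (hWz hj) (hWz hk)
    have hF₂ : IsClosedOn G W (m + 1) (fun X => F (insert z X)) := by
      refine ⟨fun X => hF.antisymm _, fun X i k j l hX hi hk hj hl hik hjl h1 h2 h3 h4
        hiX hkX hjX hlX hc => ?_⟩
      have hne : ∀ {x}, x ∈ W → x ≠ z := fun hx h => hz (h ▸ hx)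
      have := hF.square (insert z X) i k j l (Finset.insert_subset_insert _ hX) (hWz hi)
        (hWz hk) (hWz hj) (hWz hl) hik hjl h1 h2 h3 h4 (by simp [hne hi, hiX])
        (by simp [hne hk, hkX]) (by simp [hne hj, hjX]) (by simp [hne hl, hlX])
        (by rw [Finset.card_insert_of_notMem (fun h => hz (hX h))]; omega)
      simpa only [Finset.insert_comm _ z] using this
    have hY₂ : StarFluxZeroOn G W (m + 1) (fun X => F (insert z X)) := by
      intro M v i j k hM hv hi hj hk hvi hvj hvk hij hjk hik hvM hiM hjM hkM hc
      have hne : ∀ {x}, x ∈ W → x ≠ z := fun hx h => hz (h ▸ hx)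
      have := hY (insert z M) v i j k (Finset.insert_subset_insert _ hM) (hWz hv) (hWz hi)
        (hWz hj) (hWz hk) hvi hvj hvk hij hjk hik (by simp [hne hv, hvM])
        (by simp [hne hi, hiM]) (by simp [hne hj, hjM]) (by simp [hne hk, hkM])
        (by rw [Finset.card_insert_of_notMem (fun h => hz (hM h))]; omega)
      simpa only [starFlux, Finset.insert_comm _ z] using this
    obtain ⟨α₁, f₁, hα₁, h₁⟩ := ih _ _ hF₁ hY₁
    obtain ⟨α₂, f₂, hα₂, h₂⟩ := ih _ _ hF₂ hY₂
    obtain ⟨α, g₁, g₂, hα, h₁, h₂⟩ :=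
      exists_common_potential hF hY h₁ h₂ hα₁ hα₂ hW hz hu₀ hu₀z
    have hex : ∀ u, ∃ c : A, u ∈ W → G.Adj u z → ∀ X ⊆ W, u ∉ X → X.card = m + 1 →
        F X u z + g₁ (insert u X) - g₂ X = c := by
      intro u
      by_cases hu : u ∈ W ∧ G.Adj u z
      · obtain ⟨c, hc⟩ := exists_value_of_common_potential hF hY h₁ h₂ hα hW hz hu.1 hu.2
        exact ⟨c, fun _ _ => hc⟩
      · exact ⟨0, fun h h' => absurd ⟨h, h'⟩ hu⟩
    choose c hc using hex
    have hnew : ∀ X u, X ⊆ W → u ∈ W → G.Adj u z → u ∉ X → X.card = m + 1 →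
        F X u z = c u + g₂ X - g₁ (insert u X) := fun X u hX hu huz huX hcard => by
      rw [← hc u hu huz X hX huX hcard]; abel
    -- The constant `c u` becomes the value of the potential on the new edge `u → z`. The primitive
    -- is `g₁` or `g₂` according to whether `z` is empty or occupied.
    refine ⟨fun a b => if a = z then (if b = z then 0 else -c b) else
        if b = z then c a else α a b,
      fun S => if z ∈ S then g₂ (S.erase z) else g₁ S, fun a b => ?_,
      fun X u w hX hu hw huw huX hwX hcard => ?_⟩
    · by_cases ha : a = z <;> by_cases hb : b = z <;> simp [ha, hb, hα a b]
    have hmem : ∀ {x}, x ∈ insert z W → x ≠ z → x ∈ W := fun h h' =>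
      (Finset.mem_insert.1 h).resolve_left h'
    by_cases hwz : w = z
    · subst hwz
      have hXW := (Finset.subset_insert_iff_of_notMem hwX).1 hX
      have huW := hmem hu huw.ne
      simp only [huw.ne, if_false, if_true, Finset.mem_insert_self, Finset.erase_insert hwX,
        Finset.mem_insert, huw.ne', hwX, or_self]
      exact hnew X u hXW huW huw huX (by omega)
    by_cases huz : u = z
    · subst huz
      have hXW := (Finset.subset_insert_iff_of_notMem huX).1 hX
      have hwW := hmem hw hwz
      simp only [huw.ne, huw.ne', if_false, if_true, Finset.mem_insert_self,
        Finset.erase_insert huX, Finset.mem_insert, huX, or_self]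
      rw [hF.antisymm, hnew X w hXW hwW huw.symm hwX (by omega)]
      abel
    have huW := hmem hu huz
    have hwW := hmem hw hwz
    by_cases hzX : z ∈ X
    · have hXW : X.erase z ⊆ W := Finset.subset_insert_iff.1 hX
      have := h₂ (X.erase z) u w hXW huW hwW huw (fun h => huX (Finset.mem_of_mem_erase h))
        (fun h => hwX (Finset.mem_of_mem_erase h))
        (by rw [Finset.card_erase_add_one hzX]; omega)
      simp only [Finset.insert_erase hzX] at this
      simp only [huz, hwz, if_false, Finset.mem_insert, hzX, or_true, if_true]
      rw [this, Finset.erase_insert_of_ne hwz, Finset.erase_insert_of_ne huz]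
    · have hXW := (Finset.subset_insert_iff_of_notMem hzX).1 hX
      simp only [huz, hwz, if_false, Finset.mem_insert, hzX, or_false, Ne.symm huz, Ne.symm hwz]
      exact h₁ X u w hXW huW hwW huw huX hwX hcard

end GraphConf

/-! ### Parking paths and the gauge in which slides have zero flux -/

namespace GraphConf

variable {V : Type*} {A : Type*} [AddCommGroup A] {G : SimpleGraph V}

/-- A path `x 0, …, x k` without chords between its ends whose interior vertices have no further
neighbours: `n - 2 = k - 1` particles can be parked on its interior. -/
structure IsParkingPath (G : SimpleGraph V) (k : ℕ) (x : ℕ → V) : Prop where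
  inj : ∀ a b, a ≤ k → b ≤ k → x a = x b → a = b
  adj : ∀ a < k, G.Adj (x a) (x (a + 1))
  eq_or_eq : ∀ a, a + 1 < k → ∀ y, G.Adj (x (a + 1)) y → y = x a ∨ y = x (a + 2)
  not_adj : ¬G.Adj (x 0) (x k)

theorem IsParkingPath.reverse {k : ℕ} {x : ℕ → V} (hx : IsParkingPath G k x) :
    IsParkingPath G k (fun a => x (k - a)) where
  inj a b ha hb h := by
    have := hx.inj _ _ (Nat.sub_le k a) (Nat.sub_le k b) h
    omega
  adj a ha := by
    have := hx.adj (k - (a + 1)) (by omega)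
    rw [show k - (a + 1) + 1 = k - a by omega] at this
    exact this.symm
  eq_or_eq a ha y hy := by
    have := hx.eq_or_eq (k - (a + 2)) (by omega) y
    rw [show k - (a + 2) + 1 = k - (a + 1) by omega,
      show k - (a + 2) + 2 = k - a by omega] at this
    exact (this hy).symm
  not_adj h := hx.not_adj (by simpa using h.symm)

theorem IsParkingPath.ne {k : ℕ} {x : ℕ → V} (hx : IsParkingPath G k x) {a b : ℕ}
    (ha : a ≤ k) (hb : b ≤ k) (hab : a ≠ b) :
    x a ≠ x b := fun h => hab (hx.inj a b ha hb h)

variable [DecidableEq V]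

/-- The vertices of the path `x 0, …, x k`. -/
def pathVerts (x : ℕ → V) (k : ℕ) : Finset V := (Finset.range (k + 1)).image x

theorem mem_pathVerts {x : ℕ → V} {k : ℕ} {v : V} :
    v ∈ pathVerts x k ↔ ∃ a ≤ k, x a = v := by
  simp [pathVerts]

theorem pathVerts_reverse (x : ℕ → V) (k : ℕ) :
    pathVerts (fun a => x (k - a)) k = pathVerts x k := by
  ext v
  simp only [mem_pathVerts]
  constructor
  · rintro ⟨a, _, rfl⟩
    exact ⟨k - a, Nat.sub_le _ _, rfl⟩
  · rintro ⟨a, ha, rfl⟩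
    exact ⟨k - a, Nat.sub_le _ _, by rw [Nat.sub_sub_self ha]⟩

/-- The interior vertices of the path `x 0, …, x k`. -/
def pathInterior (x : ℕ → V) (k : ℕ) : Finset V := ((pathVerts x k).erase (x 0)).erase (x k)

theorem pathInterior_reverse (x : ℕ → V) (k : ℕ) :
    pathInterior (fun a => x (k - a)) k = pathInterior x k := by
  rw [pathInterior, pathVerts_reverse, pathInterior, Nat.sub_zero, Nat.sub_self,
    Finset.erase_right_comm]

/-- The flux of the cochain along the displacement, by one edge each, of all particles of
`{q, x 0, …, x (k - 1)}` on the path. -/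
def slideFlux (F : Finset V → V → V → A) (x : ℕ → V) (k : ℕ) (Q : Finset V) : A :=
  ∑ m ∈ Finset.range k, F ((Q.erase (x m)).erase (x (m + 1))) (x m) (x (m + 1))

theorem slideFlux_reverse {F : Finset V → V → V → A} (hF : ∀ X u w, F X w u = -F X u w)
    (x : ℕ → V) (k : ℕ) (Q : Finset V) :
    slideFlux F (fun a => x (k - a)) k Q = -slideFlux F x k Q := by
  rw [slideFlux, slideFlux, ← Finset.sum_range_reflect, ← Finset.sum_neg_distrib]
  refine Finset.sum_congr rfl fun m hm => ?_
  rw [Finset.mem_range] at hm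
  rw [show k - (k - 1 - m) = m + 1 by omega, show k - (k - 1 - m + 1) = m by omega, hF,
    Finset.erase_right_comm]

namespace IsParkingPath

variable {k : ℕ} {x : ℕ → V}

theorem mem_pathInterior (hx : IsParkingPath G k x) {v : V} :
    v ∈ pathInterior x k ↔ ∃ a, a + 1 < k ∧ x (a + 1) = v := by
  simp only [pathInterior, Finset.mem_erase, mem_pathVerts]
  constructor
  · rintro ⟨h1, h2, a, ha, rfl⟩
    have ha0 : a ≠ 0 := fun h => h2 (by rw [h])
    have hak : a ≠ k := fun h => h1 (by rw [h])
    exact ⟨a - 1, by omega, by rw [Nat.sub_add_cancel (by omega)]⟩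
  · rintro ⟨a, ha, rfl⟩
    refine ⟨fun h => ?_, fun h => ?_, a + 1, ha.le, rfl⟩
    · have := hx.inj _ _ ha.le le_rfl h; omega
    · have := hx.inj _ _ ha.le (Nat.zero_le _) h; omega

theorem card_pathVerts (hx : IsParkingPath G k x) : (pathVerts x k).card = k + 1 := by
  rw [pathVerts, Finset.card_image_of_injOn, Finset.card_range]
  intro a ha b hb h
  simp only [Finset.coe_range, Set.mem_Iio] at ha hb
  exact hx.inj a b (by omega) (by omega) h

theorem mem_pathVerts_of_le (_ : IsParkingPath G k x) {a : ℕ} (ha : a ≤ k) :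
    x a ∈ pathVerts x k := mem_pathVerts.2 ⟨a, ha, rfl⟩

/-- The only neighbour on the path of its first vertex is the second one. -/
theorem notMem_of_adj_zero (hx : IsParkingPath G k x) {v : V} (hv : G.Adj (x 0) v)
    (h1 : v ≠ x 1) : v ∉ pathVerts x k := by
  intro h
  obtain ⟨a, ha, rfl⟩ := mem_pathVerts.1 h
  obtain _ | a := a
  · exact hv.ne rfl
  rcases ha.lt_or_eq with hlt | heq
  · rcases hx.eq_or_eq a hlt _ hv.symm with h | h
    · have := hx.inj _ _ (Nat.zero_le _) (by omega) h
      exact h1 (by rw [← this])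
    · have := hx.inj _ _ (Nat.zero_le _) (by omega) h
      omega
  · exact hx.not_adj (heq ▸ hv)

theorem insert_erase_pathInterior_zero (hx : IsParkingPath G k x) (hk : 0 < k) :
    insert (x 0) (pathInterior x k) = (pathVerts x k).erase (x k) := by
  rw [pathInterior, Finset.erase_right_comm, Finset.insert_erase]
  exact Finset.mem_erase.2 ⟨hx.ne (Nat.zero_le _) le_rfl hk.ne,
    hx.mem_pathVerts_of_le (Nat.zero_le _)⟩

theorem insert_erase_pathInterior_last (hx : IsParkingPath G k x) (hk : 0 < k) :
    insert (x k) (pathInterior x k) = (pathVerts x k).erase (x 0) := by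
  rw [pathInterior, Finset.insert_erase]
  exact Finset.mem_erase.2 ⟨hx.ne le_rfl (Nat.zero_le _) hk.ne',
    hx.mem_pathVerts_of_le le_rfl⟩

end IsParkingPath

section Gauge

variable {n : ℕ} {F : Finset V → V → V → A}

/-- The six moves form a closed path of configurations, so the coboundary telescopes away. -/
theorem starFlux_gauge (f : Finset V → A) (M : Finset V) (v i j k : V) :
    starFlux (fun X u w => F X u w + f (insert w X) - f (insert u X)) M v i j k =
      starFlux F M v i j k := by
  simp only [starFlux, Finset.insert_comm v, Finset.insert_comm j i, Finset.insert_comm k i,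
    Finset.insert_comm k j]
  abel

/-- After a gauge transformation the slides along a path have zero flux. -/
theorem exists_slideFlux_eq_zero {k : ℕ} {x : ℕ → V} (hx : IsParkingPath G k x) (hk : 0 < k)
    (F : Finset V → V → V → A) :
    ∃ f : Finset V → A, ∀ q ∉ pathVerts x k,
      slideFlux (fun X u w => F X u w + f (insert w X) - f (insert u X)) x k
        (insert q (pathVerts x k)) = 0 := by
  -- Of the configurations in a slide only the one with the gap at `x 0` misses `x 0`. It determines
  -- `q`, hence one `f` can cancel the slide fluxes for all `q` at once.
  refine ⟨fun S => if x 0 ∈ S then 0 else -slideFlux F x k (insert (x 0) S), fun q hq => ?_⟩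
  set Q := insert q (pathVerts x k) with hQ
  have hmem : ∀ a ≤ k, x a ∈ Q := fun a ha =>
    Finset.mem_insert_of_mem (hx.mem_pathVerts_of_le ha)
  set f : Finset V → A := fun S => if x 0 ∈ S then 0 else -slideFlux F x k (insert (x 0) S)
    with hf
  have hterm : slideFlux (fun X u w => F X u w + f (insert w X) - f (insert u X)) x k Q =
      slideFlux F x k Q + ∑ m ∈ Finset.range k, (f (Q.erase (x m)) - f (Q.erase (x (m + 1)))) := by
    rw [slideFlux, slideFlux, ← Finset.sum_add_distrib]
    refine Finset.sum_congr rfl fun m hm => ?_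
    rw [Finset.mem_range] at hm
    have h1 := hx.ne (a := m) (b := m + 1) (by omega) (by omega) (by omega)
    rw [Finset.insert_erase (Finset.mem_erase.2 ⟨h1.symm, hmem _ (by omega)⟩),
      Finset.erase_right_comm,
      Finset.insert_erase (Finset.mem_erase.2 ⟨h1, hmem _ (by omega)⟩)]
    abel
  have h0 : f (Q.erase (x 0)) = -slideFlux F x k Q := by
    simp only [hf, Finset.notMem_erase, if_false, Finset.insert_erase (hmem 0 (Nat.zero_le _))]
  have hlast : f (Q.erase (x k)) = 0 := by
    simp only [hf]
    rw [if_pos]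
    exact Finset.mem_erase.2 ⟨hx.ne (Nat.zero_le _) le_rfl hk.ne, hmem 0 (Nat.zero_le _)⟩
  rw [hterm, Finset.sum_range_sub', h0, hlast]
  abel

variable [Fintype V]

theorem IsClosedOn.gauge (hF : IsClosedOn G Finset.univ n F) (f : Finset V → A) :
    IsClosedOn G Finset.univ n (fun X u w => F X u w + f (insert w X) - f (insert u X)) where
  antisymm X u w := by rw [hF.antisymm]; abel
  square X i k j l hX hi hk hj hl hik hjl h1 h2 h3 h4 h5 h6 h7 h8 hc := by
    have := hF.square X i k j l hX hi hk hj hl hik hjl h1 h2 h3 h4 h5 h6 h7 h8 hc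
    rw [Finset.insert_comm l i, Finset.insert_comm k l, Finset.insert_comm j k,
      Finset.insert_comm i j]
    linear_combination (norm := abel) this

/-- The edge `i → j` away from the path does not see where the gap in the path is. -/
theorem IsClosedOn.erase_last_eq_erase_zero {k : ℕ} {x : ℕ → V} (hx : IsParkingPath G k x)
    (hF : IsClosedOn G Finset.univ (k + 1) F)
    (hs : ∀ q ∉ pathVerts x k, slideFlux F x k (insert q (pathVerts x k)) = 0) {i j : V}
    (hij : G.Adj i j) (hi : i ∉ pathVerts x k) (hj : j ∉ pathVerts x k) :
    F ((pathVerts x k).erase (x k)) i j = F ((pathVerts x k).erase (x 0)) i j := by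
  set P := pathVerts x k with hP
  have hne : ∀ {q : V} {a : ℕ}, q ∉ P → a ≤ k → q ≠ x a := fun hq ha h =>
    hq (h ▸ hx.mem_pathVerts_of_le ha)
  -- Moving the gap past one edge of the path gives a square with `i → j`. Summed over the path, the
  -- left sides telescope and the right sides become the slide fluxes for `i` and for `j`.
  have hterm : ∀ m ∈ Finset.range k, F (P.erase (x (m + 1))) i j - F (P.erase (x m)) i j =
      F (((insert i P).erase (x m)).erase (x (m + 1))) (x m) (x (m + 1)) -
      F (((insert j P).erase (x m)).erase (x (m + 1))) (x m) (x (m + 1)) := by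
    intro m hm
    rw [Finset.mem_range] at hm
    have h1 := hx.ne (a := m) (b := m + 1) (by omega) (by omega) (by omega)
    have hm1 : x m ∈ P := hx.mem_pathVerts_of_le (by omega)
    have hm2 : x (m + 1) ∈ P := hx.mem_pathVerts_of_le (by omega)
    have hi1 := hne (a := m) hi (by omega)
    have hi2 := hne (a := m + 1) hi (by omega)
    have hj1 := hne (a := m) hj (by omega)
    have hj2 := hne (a := m + 1) hj (by omega)
    have := hF.square ((P.erase (x m)).erase (x (m + 1))) (x m) (x (m + 1)) i j
      (Finset.subset_univ _) (Finset.mem_univ _) (Finset.mem_univ _) (Finset.mem_univ _)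
      (Finset.mem_univ _) (hx.adj m hm) hij hi1.symm hj1.symm hi2.symm hj2.symm
      (by simp) (by simp) (by simp [hi]) (by simp [hj])
      (by rw [Finset.card_erase_of_mem (Finset.mem_erase.2 ⟨h1.symm, hm2⟩),
            Finset.card_erase_of_mem hm1, hx.card_pathVerts]; omega)
    have e1 : insert (x (m + 1)) ((P.erase (x m)).erase (x (m + 1))) = P.erase (x m) :=
      Finset.insert_erase (Finset.mem_erase.2 ⟨h1.symm, hm2⟩)
    have e2 : insert (x m) ((P.erase (x m)).erase (x (m + 1))) = P.erase (x (m + 1)) := by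
      rw [Finset.erase_right_comm, Finset.insert_erase (Finset.mem_erase.2 ⟨h1, hm1⟩)]
    rw [e1, e2] at this
    rw [Finset.erase_insert_of_ne hi1, Finset.erase_insert_of_ne hi2,
      Finset.erase_insert_of_ne hj1, Finset.erase_insert_of_ne hj2]
    linear_combination (norm := abel) this
  have := Finset.sum_congr rfl hterm
  rw [Finset.sum_range_sub (fun m => F (P.erase (x m)) i j), Finset.sum_sub_distrib] at this
  have hsi := hs i hi
  have hsj := hs j hj
  rw [slideFlux] at hsi hsj
  rw [hsi, hsj, sub_zero] at this
  exact sub_eq_zero.1 this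

/-- The displacement of the gap along the path, seen by the exchange of two particles on a star
centred at the first vertex of the path. -/
theorem IsClosedOn.starFlux_path_eq {k : ℕ} {x : ℕ → V} (hx : IsParkingPath G k x) (hk : 2 ≤ k)
    (hF : IsClosedOn G Finset.univ (k + 1) F)
    (hs : ∀ q ∉ pathVerts x k, slideFlux F x k (insert q (pathVerts x k)) = 0) {i j : V}
    (hi : G.Adj (x 0) i) (hj : G.Adj (x 0) j) (hi1 : i ≠ x 1) (hj1 : j ≠ x 1) (hij : i ≠ j) :
    F (insert i (pathInterior x k)) j (x 0) + F (insert j (pathInterior x k)) (x 0) i +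
        (F ((pathVerts x k).erase (x 0)) i (x 0) + F ((pathVerts x k).erase (x 0)) (x 0) j) =
      starFlux F (((pathVerts x k).erase (x 0)).erase (x 1)) (x 0) i j (x 1) := by
  set P := pathVerts x k with hP
  have hne : ∀ {q : V} {a : ℕ}, q ∉ P → a ≤ k → q ≠ x a := fun hq ha h =>
    hq (h ▸ hx.mem_pathVerts_of_le ha)
  obtain ⟨k', rfl⟩ : ∃ k', k = k' + 1 := ⟨k - 1, by omega⟩
  -- The squares that carry the gap from `x 1` to the far end, with `i` at rest and a particle
  -- moving `j → x 0`, telescope; the slide for `i`, which has zero flux, contributes its first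
  -- term. The remaining sum is symmetric in `i` and `j`, so comparing the two orders eliminates it.
  have key : ∀ i j : V, G.Adj (x 0) i → G.Adj (x 0) j → i ≠ x 1 → j ≠ x 1 → i ≠ j →
      F (insert i (pathInterior x (k' + 1))) j (x 0) -
        F (insert i ((P.erase (x 0)).erase (x 1))) j (x 0) -
        F (insert i ((P.erase (x 0)).erase (x 1))) (x 0) (x 1) =
      ∑ m ∈ Finset.range k', F (insert i (insert j
        (((P.erase (x 0)).erase (x (m + 1))).erase (x (m + 2))))) (x (m + 1)) (x (m + 2)) := by
    intro i j hi hj hi1 hj1 hij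
    have hiP := hx.notMem_of_adj_zero hi hi1
    have hjP := hx.notMem_of_adj_zero hj hj1
    have hterm : ∀ m ∈ Finset.range k',
        F (insert i ((P.erase (x 0)).erase (x (m + 1 + 1)))) j (x 0) -
          F (insert i ((P.erase (x 0)).erase (x (m + 1)))) j (x 0) =
        F (insert i (insert j
          (((P.erase (x 0)).erase (x (m + 1))).erase (x (m + 2))))) (x (m + 1)) (x (m + 2)) -
        F (((insert i P).erase (x (m + 1))).erase (x (m + 2))) (x (m + 1)) (x (m + 2)) := by
      intro m hm
      rw [Finset.mem_range] at hm
      have h1 := hx.ne (a := m + 1) (b := m + 2) (by omega) (by omega) (by omega)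
      have h01 := hx.ne (a := 0) (b := m + 1) (by omega) (by omega) (by omega)
      have h02 := hx.ne (a := 0) (b := m + 2) (by omega) (by omega) (by omega)
      have hm0 : x 0 ∈ P := hx.mem_pathVerts_of_le (by omega)
      have hm1 : x (m + 1) ∈ P := hx.mem_pathVerts_of_le (by omega)
      have hm2 : x (m + 2) ∈ P := hx.mem_pathVerts_of_le (by omega)
      have hi0 := hne (a := 0) hiP (by omega)
      have hi1 := hne (a := m + 1) hiP (by omega)
      have hi2 := hne (a := m + 2) hiP (by omega)
      have hj0 := hne (a := 0) hjP (by omega)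
      have hj1 := hne (a := m + 1) hjP (by omega)
      have hj2 := hne (a := m + 2) hjP (by omega)
      set Z := ((P.erase (x 0)).erase (x (m + 1))).erase (x (m + 2)) with hZ
      have hZP : Z ⊆ P := ((Finset.erase_subset _ _).trans (Finset.erase_subset _ _)).trans
        (Finset.erase_subset _ _)
      have e1 : insert (x (m + 2)) Z = (P.erase (x 0)).erase (x (m + 1)) :=
        Finset.insert_erase (by simp [h1.symm, h02.symm, hm2])
      have e2 : insert (x (m + 1)) Z = (P.erase (x 0)).erase (x (m + 2)) := by
        rw [hZ, Finset.erase_right_comm, Finset.insert_erase (by simp [h1, h01.symm, hm1])]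
      have e3 : insert (x 0) Z = (P.erase (x (m + 1))).erase (x (m + 2)) := by
        rw [hZ, Finset.erase_right_comm (a := x 0), Finset.erase_right_comm (a := x 0),
          Finset.insert_erase (by simp [h01, h02, hm0])]
      have hcard : Z.card + 3 = k' + 1 + 1 := by
        have c1 := Finset.card_erase_add_one hm0
        have c2 := Finset.card_erase_add_one (s := P.erase (x 0)) (a := x (m + 1))
          (by simp [h01.symm, hm1])
        have c3 := Finset.card_erase_add_one (s := (P.erase (x 0)).erase (x (m + 1)))
          (a := x (m + 2)) (by simp [h1.symm, h02.symm, hm2])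
        rw [hx.card_pathVerts] at c1
        rw [← hZ] at c3
        omega
      have hiZ : i ∉ Z := fun h => hiP (hZP h)
      have hjZ : j ∉ Z := fun h => hjP (hZP h)
      have := hF.square (insert i Z) (x (m + 1)) (x (m + 2)) j (x 0)
        (Finset.subset_univ _) (Finset.mem_univ _) (Finset.mem_univ _) (Finset.mem_univ _)
        (Finset.mem_univ _) (hx.adj (m + 1) (by omega)) hj.symm hj1.symm h01.symm hj2.symm
        h02.symm (by simp [hi1.symm, hZ]) (by simp [hi2.symm, hZ]) (by simp [hij.symm, hjZ])
        (by simp [hi0.symm, hZ]) (by rw [Finset.card_insert_of_notMem hiZ]; omega)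
      rw [Finset.insert_comm _ i, Finset.insert_comm _ i, Finset.insert_comm _ i,
        Finset.insert_comm _ i, e1, e2, e3] at this
      rw [Finset.erase_insert_of_ne hi1, Finset.erase_insert_of_ne hi2]
      linear_combination (norm := abel) this
    have hsum := Finset.sum_congr rfl hterm
    rw [Finset.sum_range_sub
        (fun m => F (insert i ((P.erase (x 0)).erase (x (m + 1)))) j (x 0)),
      Finset.sum_sub_distrib] at hsum
    have hsi := hs i hiP
    rw [slideFlux, Finset.sum_range_succ', zero_add,
      Finset.erase_insert_of_ne (hne hiP (Nat.zero_le _)),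
      Finset.erase_insert_of_ne (hne hiP (by omega))] at hsi
    have hS : ∑ m ∈ Finset.range k', F (((insert i P).erase (x (m + 1))).erase (x (m + 2)))
        (x (m + 1)) (x (m + 2)) = _ := eq_neg_of_add_eq_zero_left hsi
    rw [hS, zero_add] at hsum
    rw [pathInterior, ← hP, hsum]
    abel
  have h1 := key i j hi hj hi1 hj1 hij
  have h2 := key j i hj hi hj1 hi1 hij.symm
  simp only [Finset.insert_comm i j] at h1
  simp only [hF.antisymm _ (x 0) i] at h2
  have h3 : insert (x 1) ((P.erase (x 0)).erase (x 1)) = P.erase (x 0) :=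
    Finset.insert_erase (Finset.mem_erase.2 ⟨hx.ne (by omega) (by omega) (by omega),
      hx.mem_pathVerts_of_le (by omega)⟩)
  rw [← h2] at h1
  simp only [starFlux, h3, hF.antisymm _ (x 0) (x 1), hF.antisymm _ (x 0) i]
  linear_combination (norm := abel) h1

end Gauge

end GraphConf

/-! ### The two-particle cochain obtained by parking -/

namespace GraphConf

variable {V : Type*} {A : Type*} [AddCommGroup A] {G : SimpleGraph V}

/-- The function `T` of the values `T p i j` on `{p, i → j}` is a closed two-particle cochain. -/
structure IsClosedPair (G : SimpleGraph V) (T : V → V → V → A) : Prop where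
  antisymm : ∀ p i j, T p j i = -T p i j
  square : ∀ i k j l, G.Adj i k → G.Adj j l → i ≠ j → i ≠ l → k ≠ j → k ≠ l →
    T i j l + T l i k = T k j l + T j i k

/-- The flux of a two-particle cochain through the exchange on a star. -/
def pairStarFlux (T : V → V → V → A) (v i j k : V) : A :=
  T i j v + T i v k + (T k i v + T k v j) + (T j k v + T j v i)

theorem pairStarFlux_rotate (T : V → V → V → A) (v i j k : V) :
    pairStarFlux T v j k i = pairStarFlux T v i j k := by
  unfold pairStarFlux; abel

/-- The interaction of the moving particle with each of the others by a two-particle cochain. -/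
def pairSum (T : V → V → V → A) (X : Finset V) (u w : V) : A := ∑ p ∈ X, T p u w

variable [DecidableEq V]

theorem starFlux_rotate (F : Finset V → V → V → A) (M : Finset V) (v i j k : V) :
    starFlux F M v j k i = starFlux F M v i j k := by
  unfold starFlux; abel

/-- During the exchange each leg of the star is traversed once in each direction, so the
interactions with the spectators in `M` cancel. -/
theorem starFlux_pairSum {T : V → V → V → A} (hT : ∀ p i j, T p j i = -T p i j)
    {M : Finset V} {v i j k : V} (hi : i ∉ M) (hj : j ∉ M) (hk : k ∉ M) :
    starFlux (pairSum T) M v i j k = pairStarFlux T v i j k := by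
  have h : ∀ a b, pairSum T M a b = -pairSum T M b a := fun a b => by
    simp only [pairSum, hT _ b a, Finset.sum_neg_distrib]
  have e : ∀ q a b, q ∉ M → pairSum T (insert q M) a b = T q a b + pairSum T M a b :=
    fun q a b hq => Finset.sum_insert hq
  rw [starFlux, pairStarFlux, e i _ _ hi, e i _ _ hi, e j _ _ hj, e j _ _ hj, e k _ _ hk,
    e k _ _ hk, h j v, h i v, h k v]
  abel

theorem IsClosedPair.isClosedOn_pairSum [Fintype V] {T : V → V → V → A} (hT : IsClosedPair G T)
    (n : ℕ) : IsClosedOn G Finset.univ n (pairSum T) where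
  antisymm X u w := by simp only [pairSum, hT.antisymm _ u w, Finset.sum_neg_distrib]
  square X i k j l _ _ _ _ _ hik hjl h1 h2 h3 h4 hi hk hj hl _ := by
    simp only [pairSum, Finset.sum_insert hi, Finset.sum_insert hj, Finset.sum_insert hk,
      Finset.sum_insert hl]
    linear_combination (norm := abel) hT.square i k j l hik hjl h1 h2 h3 h4

/-- The two-particle cochain obtained from `F` by parking the other particles on `I`; a particle
on `I` pushes one of the parked ones to `y` or `z`. -/
def parkedPair (F : Finset V → V → V → A) (I : Finset V) (y z p i j : V) : A :=
  if i ∈ I ∨ j ∈ I then 0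
  else if p ∈ I then
    if y = i ∨ y = j then F (insert z I) i j else F (insert y I) i j
  else F (insert p I) i j

section Parked

variable {F : Finset V → V → V → A} {I : Finset V} {y z p i j : V}

theorem parkedPair_of_mem (h : i ∈ I ∨ j ∈ I) : parkedPair F I y z p i j = 0 := if_pos h

theorem parkedPair_of_notMem (hp : p ∉ I) (hi : i ∉ I) (hj : j ∉ I) :
    parkedPair F I y z p i j = F (insert p I) i j := by
  rw [parkedPair, if_neg (by tauto), if_neg hp]

variable {k : ℕ} {x : ℕ → V}

theorem IsParkingPath.eq_end_of_adj (hx : IsParkingPath G k x) (hij : G.Adj i j)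
    (hi : i ∈ pathInterior x k) (hj : j ∉ pathInterior x k) : j = x 0 ∨ j = x k := by
  obtain ⟨a, ha, rfl⟩ := hx.mem_pathInterior.1 hi
  have hmem : ∀ b, b ≤ k → j = x b → j = x 0 ∨ j = x k := by
    rintro b hb rfl
    by_contra! h
    exact hj (by simp [pathInterior, h.1, h.2, hx.mem_pathVerts_of_le hb])
  rcases hx.eq_or_eq a ha j hij with h | h
  · exact hmem a (by omega) h
  · exact hmem (a + 2) (by omega) h

variable [Fintype V]

/-- Any end off the moving edge may receive the displaced particle. If both are off it, the slide
gauge makes the two choices agree through `IsClosedOn.erase_last_eq_erase_zero`. -/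
theorem parkedPair_of_mem_pathInterior (hx : IsParkingPath G k x) (hk : 2 ≤ k)
    (hF : IsClosedOn G Finset.univ (k + 1) F)
    (hs : ∀ q ∉ pathVerts x k, slideFlux F x k (insert q (pathVerts x k)) = 0)
    (hp : p ∈ pathInterior x k) (hi : i ∉ pathInterior x k) (hj : j ∉ pathInterior x k)
    (hij : G.Adj i j) {q : V} (hq : q = x 0 ∨ q = x k) (hqi : q ≠ i) (hqj : q ≠ j) :
    parkedPair F (pathInterior x k) (x 0) (x k) p i j =
      F (insert q (pathInterior x k)) i j := by
  rw [parkedPair, if_neg (by tauto), if_pos hp]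
  by_cases h0 : x 0 = i ∨ x 0 = j
  · rw [if_pos h0]
    rcases hq with rfl | rfl
    · tauto
    · rfl
  rw [if_neg h0]
  push Not at h0
  rcases hq with rfl | rfl
  · rfl
  have hP : ∀ {v}, v ∉ pathInterior x k → x 0 ≠ v → x k ≠ v → v ∉ pathVerts x k :=
    fun h1 h2 h3 h => h1 (by simp [pathInterior, h, h2.symm, h3.symm])
  rw [hx.insert_erase_pathInterior_zero (by omega), hx.insert_erase_pathInterior_last (by omega)]
  exact hF.erase_last_eq_erase_zero hx hs hij (hP hi h0.1 hqi) (hP hj h0.2 hqj)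

/-- An edge that meets the interior of the path does not act on moves away from it. -/
theorem parkedPair_eq_of_adj (hx : IsParkingPath G k x) (hk : 2 ≤ k)
    (hF : IsClosedOn G Finset.univ (k + 1) F)
    (hs : ∀ q ∉ pathVerts x k, slideFlux F x k (insert q (pathVerts x k)) = 0) {a b : V}
    (hab : G.Adj a b) (ha : a ∈ pathInterior x k)
    (hij : G.Adj i j) (hi : i ∉ pathInterior x k) (hj : j ∉ pathInterior x k)
    (hbi : b ≠ i) (hbj : b ≠ j) :
    parkedPair F (pathInterior x k) (x 0) (x k) a i j =
      parkedPair F (pathInterior x k) (x 0) (x k) b i j := by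
  by_cases hb : b ∈ pathInterior x k
  · rw [parkedPair, parkedPair, if_pos ha, if_pos hb]
  · rw [parkedPair_of_notMem hb hi hj]
    exact parkedPair_of_mem_pathInterior hx hk hF hs ha hi hj hij
      (hx.eq_end_of_adj hab ha hb) hbi hbj

theorem isClosedPair_parkedPair (hx : IsParkingPath G k x) (hk : 2 ≤ k)
    (hF : IsClosedOn G Finset.univ (k + 1) F)
    (hs : ∀ q ∉ pathVerts x k, slideFlux F x k (insert q (pathVerts x k)) = 0) :
    IsClosedPair G (parkedPair F (pathInterior x k) (x 0) (x k)) where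
  antisymm p i j := by
    by_cases h : i ∈ pathInterior x k ∨ j ∈ pathInterior x k
    · rw [parkedPair_of_mem h, parkedPair_of_mem h.symm, neg_zero]
    · simp only [parkedPair, or_comm (a := j ∈ _), or_comm (a := x 0 = j), hF.antisymm _ i j]
      split_ifs <;> simp
  square i k' j l hik hjl hij hil hkj hkl := by
    -- When one edge of the square meets the interior, moves along it count zero, and closedness
    -- says that a move along the other edge does not see which end of the first is occupied. When
    -- neither does, this is a square of `F` with the interior added.
    by_cases h1 : i ∈ pathInterior x k ∨ k' ∈ pathInterior x k <;>
      by_cases h2 : j ∈ pathInterior x k ∨ l ∈ pathInterior x k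
    · simp only [parkedPair_of_mem h1, parkedPair_of_mem h2]
    · push Not at h2
      rw [parkedPair_of_mem h1, parkedPair_of_mem h1, add_zero, add_zero]
      rcases h1 with h | h
      · exact parkedPair_eq_of_adj hx hk hF hs hik h hjl h2.1 h2.2 hkj hkl
      · exact (parkedPair_eq_of_adj hx hk hF hs hik.symm h hjl h2.1 h2.2 hij hil).symm
    · push Not at h1
      rw [parkedPair_of_mem h2, parkedPair_of_mem h2, zero_add, zero_add]
      rcases h2 with h | h
      · exact (parkedPair_eq_of_adj hx hk hF hs hjl h hik h1.1 h1.2 hil.symm hkl.symm).symm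
      · exact parkedPair_eq_of_adj hx hk hF hs hjl.symm h hik h1.1 h1.2 hij.symm hkj.symm
    · push Not at h1 h2
      rw [parkedPair_of_notMem h1.1 h2.1 h2.2, parkedPair_of_notMem h2.2 h1.1 h1.2,
        parkedPair_of_notMem h1.2 h2.1 h2.2, parkedPair_of_notMem h2.1 h1.1 h1.2]
      refine hF.square _ i k' j l (Finset.subset_univ _) (Finset.mem_univ _) (Finset.mem_univ _)
        (Finset.mem_univ _) (Finset.mem_univ _) hik hjl hij hil hkj hkl h1.1 h1.2 h2.1 h2.2 ?_
      have c1 := Finset.card_erase_add_one (hx.mem_pathVerts_of_le (Nat.zero_le k))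
      have c2 := Finset.card_erase_add_one (s := (pathVerts x k).erase (x 0)) (a := x k)
        (Finset.mem_erase.2 ⟨hx.ne le_rfl (Nat.zero_le _) (by omega),
          hx.mem_pathVerts_of_le le_rfl⟩)
      rw [hx.card_pathVerts] at c1
      rw [pathInterior]
      omega

end Parked

end GraphConf

/-! ### Star fluxes of the parked cochain -/

namespace GraphConf

variable {V : Type*} {A : Type*} [AddCommGroup A] {G : SimpleGraph V} [DecidableEq V]
  {F : Finset V → V → V → A} {k : ℕ} {x : ℕ → V}

theorem card_erase_erase_pathVerts (hx : IsParkingPath G k x) {a b : ℕ} (ha : a ≤ k) (hb : b ≤ k)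
    (hab : a ≠ b) : (((pathVerts x k).erase (x a)).erase (x b)).card + 2 = k + 1 := by
  have c1 := Finset.card_erase_add_one (hx.mem_pathVerts_of_le ha)
  have c2 := Finset.card_erase_add_one (s := (pathVerts x k).erase (x a)) (a := x b)
    (Finset.mem_erase.2 ⟨hx.ne hb ha hab.symm, hx.mem_pathVerts_of_le hb⟩)
  rw [hx.card_pathVerts] at c1
  omega

variable [Fintype V]

/-- With the leaf `x 1` on the interior, its own moves vanish and as a spectator it pushes a
particle to `x k`; `IsClosedOn.starFlux_path_eq` evaluates the four surviving terms. `T` is given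
only by properties symmetric in the two ends, so that the reversed path can be used with the same
cochain. -/
theorem pairStarFlux_first_vertex (hx : IsParkingPath G k x) (hk : 2 ≤ k)
    (hF : IsClosedOn G Finset.univ (k + 1) F)
    (hs : ∀ q ∉ pathVerts x k, slideFlux F x k (insert q (pathVerts x k)) = 0)
    {T : V → V → V → A}
    (hT₀ : ∀ p i j, i ∈ pathInterior x k ∨ j ∈ pathInterior x k → T p i j = 0)
    (hT₁ : ∀ p i j, p ∉ pathInterior x k → i ∉ pathInterior x k → j ∉ pathInterior x k →
      T p i j = F (insert p (pathInterior x k)) i j)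
    (hT₂ : ∀ p i j q, p ∈ pathInterior x k → i ∉ pathInterior x k → j ∉ pathInterior x k →
      G.Adj i j → q = x 0 ∨ q = x k → q ≠ i → q ≠ j →
      T p i j = F (insert q (pathInterior x k)) i j)
    {i j : V} (hi : G.Adj (x 0) i) (hj : G.Adj (x 0) j) (hi1 : i ≠ x 1) (hj1 : j ≠ x 1)
    (hij : i ≠ j) :
    pairStarFlux T (x 0) i j (x 1) =
      starFlux F (((pathVerts x k).erase (x 0)).erase (x 1)) (x 0) i j (x 1) := by
  have hiP := hx.notMem_of_adj_zero hi hi1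
  have hjP := hx.notMem_of_adj_zero hj hj1
  have hsub : pathInterior x k ⊆ pathVerts x k :=
    (Finset.erase_subset _ _).trans (Finset.erase_subset _ _)
  have hiI : i ∉ pathInterior x k := fun h => hiP (hsub h)
  have hjI : j ∉ pathInterior x k := fun h => hjP (hsub h)
  have h0I : x 0 ∉ pathInterior x k := by simp [pathInterior]
  have h1I : x 1 ∈ pathInterior x k := hx.mem_pathInterior.2 ⟨0, by omega, rfl⟩
  have hkP := hx.mem_pathVerts_of_le (le_refl k)
  have hki : x k ≠ i := fun h => hiP (h ▸ hkP)
  have hkj : x k ≠ j := fun h => hjP (h ▸ hkP)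
  have hk0 : x k ≠ x 0 := hx.ne le_rfl (Nat.zero_le _) (by omega)
  rw [← hF.starFlux_path_eq hx hk hs hi hj hi1 hj1 hij, pairStarFlux,
    hT₀ i (x 0) (x 1) (.inr h1I), hT₀ j (x 1) (x 0) (.inl h1I), hT₁ i j (x 0) hiI hjI h0I,
    hT₁ j (x 0) i hjI h0I hiI, hT₂ (x 1) i (x 0) (x k) h1I hiI h0I hi.symm (.inr rfl) hki hk0,
    hT₂ (x 1) (x 0) j (x k) h1I h0I hjI hj (.inr rfl) hk0 hkj,
    hx.insert_erase_pathInterior_last (by omega)]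
  abel

/-- The two-particle cochain obtained by parking has the same fluxes through exchanges on stars
as the original cochain. -/
theorem pairStarFlux_parkedPair (hx : IsParkingPath G k x) (hk : 2 ≤ k)
    (hF : IsClosedOn G Finset.univ (k + 1) F)
    (hs : ∀ q ∉ pathVerts x k, slideFlux F x k (insert q (pathVerts x k)) = 0)
    (hconst : ∀ v i j k' : V, G.Adj v i → G.Adj v j → G.Adj v k' → i ≠ j → j ≠ k' → i ≠ k' →
      ∀ M M' : Finset V, v ∉ M → i ∉ M → j ∉ M → k' ∉ M → v ∉ M' → i ∉ M' → j ∉ M' → k' ∉ M' →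
        M.card + 2 = k + 1 → M'.card + 2 = k + 1 → starFlux F M v i j k' = starFlux F M' v i j k')
    {v i j k' : V} (hi : G.Adj v i) (hj : G.Adj v j) (hk' : G.Adj v k') (hij : i ≠ j)
    (hjk : j ≠ k') (hik : i ≠ k') {M : Finset V} (hvM : v ∉ M) (hiM : i ∉ M) (hjM : j ∉ M)
    (hkM : k' ∉ M) (hM : M.card + 2 = k + 1) :
    pairStarFlux (parkedPair F (pathInterior x k) (x 0) (x k)) v i j k' =
      starFlux F M v i j k' := by
  -- A vertex with three neighbours cannot be interior to the path.
  have hvI : v ∉ pathInterior x k := by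
    intro h
    obtain ⟨a, ha, rfl⟩ := hx.mem_pathInterior.1 h
    rcases hx.eq_or_eq a ha i hi with h1 | h1 <;> rcases hx.eq_or_eq a ha j hj with h2 | h2 <;>
      rcases hx.eq_or_eq a ha k' hk' with h3 | h3 <;> simp_all
  have key : ∀ i j k' : V, G.Adj v i → G.Adj v j → G.Adj v k' → i ≠ j → j ≠ k' → i ≠ k' →
      i ∉ M → j ∉ M → k' ∉ M → k' ∈ pathInterior x k →
      pairStarFlux (parkedPair F (pathInterior x k) (x 0) (x k)) v i j k' =
        starFlux F M v i j k' := by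
    intro i j k' hi hj hk' hij hjk hik hiM hjM hkM hkI
    -- If a leaf lies on the interior, the centre `v` is an end of the path. Here `y` is the path
    -- directed so that it starts at `v`.
    have core : ∀ y : ℕ → V, IsParkingPath G k y → pathVerts y k = pathVerts x k →
        pathInterior y k = pathInterior x k →
        (∀ q, q = y 0 ∨ q = y k → q = x 0 ∨ q = x k) →
        (∀ q ∉ pathVerts y k, slideFlux F y k (insert q (pathVerts y k)) = 0) → v = y 0 →
        pairStarFlux (parkedPair F (pathInterior x k) (x 0) (x k)) v i j k' =
          starFlux F M v i j k' := by
      rintro y hy hPy hIy hends hsy rfl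
      obtain ⟨a, ha, rfl⟩ := hy.mem_pathInterior.1 (hIy ▸ hkI)
      have ha0 : a = 0 := by
        rcases hy.eq_or_eq a ha _ hk'.symm with h | h <;>
          have := hy.inj _ _ (by omega) (by omega) h <;> omega
      subst ha0
      rw [hconst (y 0) i j (y (0 + 1)) hi hj hk' hij hjk hik M
        (((pathVerts y k).erase (y 0)).erase (y 1)) hvM hiM hjM hkM (by simp)
        (by simp [hy.notMem_of_adj_zero hi hik]) (by simp [hy.notMem_of_adj_zero hj hjk])
        (by simp) hM (card_erase_erase_pathVerts hy (by omega) (by omega) (by omega))]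
      refine pairStarFlux_first_vertex hy hk hF hsy ?_ ?_ ?_ hi hj hik hjk hij <;> rw [hIy]
      · exact fun p i j h => parkedPair_of_mem h
      · exact fun p i j => parkedPair_of_notMem
      · exact fun p i j q hp hi hj hij hq => parkedPair_of_mem_pathInterior hx hk hF hs hp hi hj
          hij (hends q hq)
    rcases hx.eq_end_of_adj hk'.symm hkI hvI with h | h
    · exact core x hx rfl rfl (fun _ => id) hs h
    · refine core _ hx.reverse (pathVerts_reverse x k) (pathInterior_reverse x k)
        (fun q hq => by simpa [or_comm] using hq) (fun q hq => ?_) (by simpa using h)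
      rw [pathVerts_reverse] at hq ⊢
      rw [slideFlux_reverse hF.antisymm, hs q hq, neg_zero]
  by_cases hkI : k' ∈ pathInterior x k
  · exact key i j k' hi hj hk' hij hjk hik hiM hjM hkM hkI
  by_cases hjI : j ∈ pathInterior x k
  · rw [← pairStarFlux_rotate, ← pairStarFlux_rotate, ← starFlux_rotate, ← starFlux_rotate]
    exact key k' i j hk' hi hj hik.symm hij hjk.symm hkM hiM hjM hjI
  by_cases hiI : i ∈ pathInterior x k
  · rw [← pairStarFlux_rotate, ← starFlux_rotate]
    exact key j k' i hj hk' hi hjk hik.symm hij.symm hjM hkM hiM hiI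
  -- The star misses the interior, so the spectators may be placed exactly on the parking places.
  rw [hconst v i j k' hi hj hk' hij hjk hik M (pathInterior x k) hvM hiM hjM hkM hvI hiI hjI hkI
    hM (card_erase_erase_pathVerts hx (by omega) (by omega) (by omega)), pairStarFlux, starFlux]
  simp only [parkedPair_of_notMem, hvI, hiI, hjI, hkI, not_false_eq_true]

end GraphConf

/-! ### Consequences of subdivision and 2-connectedness -/

namespace GraphConf

variable {V : Type*} {G : SimpleGraph V} {k : ℕ}

theorem exists_walk_of_seq {x : ℕ → V} {m : ℕ} (h : ∀ a < m, G.Adj (x a) (x (a + 1))) :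
    ∃ p : G.Walk (x 0) (x m), p.length = m ∧ p.support = (List.range (m + 1)).map x ∧
      p.edges = (List.range m).map fun a => s(x a, x (a + 1)) := by
  induction m with
  | zero => exact ⟨.nil, by simp⟩
  | succ m ih =>
    obtain ⟨p, hl, hs, he⟩ := ih fun a ha => h a (by omega)
    refine ⟨p.concat (h m (by omega)), by simp [hl], ?_, ?_⟩
    · rw [SimpleGraph.Walk.support_concat, hs, List.range_succ (n := m + 1)]
      simp
    · rw [SimpleGraph.Walk.edges_concat, he, List.range_succ]
      simp

theorem exists_isPath_of_seq {x : ℕ → V} {m : ℕ} (h : ∀ a < m, G.Adj (x a) (x (a + 1)))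
    (hinj : ∀ a b, a ≤ m → b ≤ m → x a = x b → a = b) :
    ∃ p : G.Walk (x 0) (x m), p.IsPath ∧ p.length = m ∧
      p.edges = (List.range m).map fun a => s(x a, x (a + 1)) := by
  obtain ⟨p, hl, hs, he⟩ := exists_walk_of_seq h
  refine ⟨p, SimpleGraph.Walk.IsPath.mk' ?_, hl, he⟩
  rw [hs]
  refine List.Nodup.map_on (fun a ha b hb => ?_) List.nodup_range
  rw [List.mem_range] at ha hb
  exact hinj a b (by omega) (by omega)

/-- A chord of a path closes a cycle. -/
theorem IsSufficientlySubdivided.le_of_chord {n : ℕ} (hG : IsSufficientlySubdivided G n)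
    {x : ℕ → V} {m : ℕ} (h : ∀ a < m, G.Adj (x a) (x (a + 1)))
    (hinj : ∀ a b, a ≤ m → b ≤ m → x a = x b → a = b) {a b : ℕ} (hab : a + 2 ≤ b) (hb : b ≤ m)
    (hadj : G.Adj (x b) (x a)) : n ≤ b - a := by
  obtain ⟨c, rfl⟩ : ∃ c, b = a + c := ⟨b - a, by omega⟩
  obtain ⟨p, hp, hl, he⟩ := exists_isPath_of_seq (G := G) (x := fun t => x (a + t)) (m := c)
    (fun t ht => h (a + t) (by omega))
    (fun s t hs ht hst => by have := hinj _ _ (by omega) (by omega) hst; omega)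
  have hc := hG.2 _ (SimpleGraph.Walk.cons hadj p) ((SimpleGraph.Walk.cons_isCycle_iff p hadj).2
    ⟨hp, fun hmem => ?_⟩)
  · rw [SimpleGraph.Walk.length_cons, hl] at hc
    omega
  · rw [he, List.mem_map] at hmem
    obtain ⟨t, ht, hst⟩ := hmem
    rw [List.mem_range] at ht
    rw [Sym2.eq_iff] at hst
    rcases hst with ⟨h1, h2⟩ | ⟨h1, h2⟩
    · have := hinj _ _ (by omega) (by omega) h1; omega
    · have := hinj _ _ (by omega) (by omega) h2
      have := hinj _ _ (by omega) (by omega) h1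
      omega

theorem ncard_neighborSet_ne_two {v i j l : V} (hi : G.Adj v i) (hj : G.Adj v j)
    (hl : G.Adj v l) (hij : i ≠ j) (hjl : j ≠ l) (hil : i ≠ l) :
    (G.neighborSet v).ncard ≠ 2 := by
  intro h
  obtain ⟨a, b, -, hab⟩ := Set.ncard_eq_two.1 h
  have h1 : i ∈ ({a, b} : Set V) := hab ▸ hi
  have h2 : j ∈ ({a, b} : Set V) := hab ▸ hj
  have h3 : l ∈ ({a, b} : Set V) := hab ▸ hl
  simp only [Set.mem_insert_iff, Set.mem_singleton_iff] at h1 h2 h3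
  rcases h1 with rfl | rfl <;> rcases h2 with rfl | rfl <;> rcases h3 with rfl | rfl <;>
    first | exact hij rfl | exact hjl rfl | exact hil rfl

theorem eq_or_eq_of_ncard_eq_two {v a b y : V} (h : (G.neighborSet v).ncard = 2)
    (ha : G.Adj v a) (hb : G.Adj v b) (hab : a ≠ b) (hy : G.Adj v y) : y = a ∨ y = b := by
  by_contra! hne
  exact ncard_neighborSet_ne_two ha hb hy hab hne.2.symm hne.1.symm h

theorem exists_adj_ne_of_ncard_eq_two {v : V} (h : (G.neighborSet v).ncard = 2) (a : V) :
    ∃ b, G.Adj v b ∧ b ≠ a := by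
  obtain ⟨b, c, hbc, hs⟩ := Set.ncard_eq_two.1 h
  have hb : G.Adj v b := by change b ∈ G.neighborSet v; simp [hs]
  have hc : G.Adj v c := by change c ∈ G.neighborSet v; simp [hs]
  by_cases hba : b = a
  · exact ⟨c, hc, fun h => hbc (hba.trans h.symm)⟩
  · exact ⟨b, hb, hba⟩

theorem IsSufficientlySubdivided.ncard_eq_two_of_seq (hG : IsSufficientlySubdivided G (k + 1))
    {x : ℕ → V} {m : ℕ} (h : ∀ a < m, G.Adj (x a) (x (a + 1)))
    (hinj : ∀ a b, a ≤ m → b ≤ m → x a = x b → a = b)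
    (h0 : (G.neighborSet (x 0)).ncard ≠ 2) (hm : 0 < m) (hmk : m < k) :
    (G.neighborSet (x m)).ncard = 2 := by
  by_contra hne
  obtain ⟨p, hp, hl, -⟩ := exists_isPath_of_seq h hinj
  have := hG.1 _ _ p (fun h => by have := hinj _ _ (Nat.zero_le _) le_rfl h; omega) h0 hne hp
  omega

/-- The path is prolonged one edge at a time. Before length `k` its last vertex has valence two, so
there is a way on, and returning to the path would close a cycle that is too short. -/
theorem IsSufficientlySubdivided.exists_seq (hG : IsSufficientlySubdivided G (k + 1)) {v i : V}
    (hv : (G.neighborSet v).ncard ≠ 2) (hi : G.Adj v i) {m : ℕ} (hm : m + 1 ≤ k) :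
    ∃ x : ℕ → V, x 0 = v ∧ (∀ a < m + 1, G.Adj (x a) (x (a + 1))) ∧
      ∀ a b, a ≤ m + 1 → b ≤ m + 1 → x a = x b → a = b := by
  induction m with
  | zero =>
    refine ⟨fun a => if a = 0 then v else i, rfl, fun a ha => ?_, fun a b ha hb hab => ?_⟩
    · obtain rfl : a = 0 := by omega
      simpa using hi
    · obtain rfl | rfl : a = 0 ∨ a = 1 := by omega
      all_goals obtain rfl | rfl : b = 0 ∨ b = 1 := by omega
      all_goals first | rfl | exact absurd hab (by simp [hi.ne, hi.ne'])
  | succ m ih =>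
    obtain ⟨x, h0, hadj, hinj⟩ := ih (by omega)
    have hdeg := hG.ncard_eq_two_of_seq hadj hinj (h0 ▸ hv) (Nat.succ_pos m) (by omega)
    obtain ⟨w, hw, hwne⟩ := exists_adj_ne_of_ncard_eq_two hdeg (x m)
    have hnew : ∀ a ≤ m + 1, x a ≠ w := by
      rintro a ha rfl
      have h1 : a ≠ m + 1 := fun h => by subst h; exact hw.ne rfl
      have h2 : a ≠ m := fun h => hwne (by rw [h])
      have := hG.le_of_chord hadj hinj (a := a) (b := m + 1) (by omega) le_rfl hw
      omega
    refine ⟨Function.update x (m + 2) w, ?_, fun a ha => ?_, fun a b ha hb hab => ?_⟩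
    · rw [Function.update_of_ne (by omega), h0]
    · rw [Function.update_of_ne (by omega : a ≠ m + 2)]
      rcases Nat.lt_or_ge a (m + 1) with hlt | hge
      · rw [Function.update_of_ne (by omega)]
        exact hadj a hlt
      · obtain rfl : a = m + 1 := by omega
        rwa [Function.update_self]
    · by_cases ha' : a = m + 2 <;> by_cases hb' : b = m + 2
      · omega
      · rw [ha', Function.update_self, Function.update_of_ne hb'] at hab
        exact absurd hab.symm (hnew b (by omega))
      · rw [hb', Function.update_self, Function.update_of_ne ha'] at hab
        exact absurd hab (hnew a (by omega))
      · rw [Function.update_of_ne ha', Function.update_of_ne hb'] at hab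
        exact hinj a b (by omega) (by omega) hab

theorem IsSufficientlySubdivided.exists_isParkingPath
    (hG : IsSufficientlySubdivided G (k + 1)) (hk : 2 ≤ k) {v i : V}
    (hv : (G.neighborSet v).ncard ≠ 2) (hi : G.Adj v i) : ∃ x, IsParkingPath G k x := by
  obtain ⟨m, rfl⟩ : ∃ m, k = m + 1 := ⟨k - 1, by omega⟩
  obtain ⟨x, rfl, hadj, hinj⟩ := hG.exists_seq hv hi (m := m) le_rfl
  refine ⟨x, hinj, hadj, fun a ha y hy => ?_, fun h => ?_⟩
  · have hdeg := hG.ncard_eq_two_of_seq (m := a + 1) (fun b hb => hadj b (by omega))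
      (fun b c hb hc => hinj b c (by omega) (by omega)) hv (Nat.succ_pos a) ha
    refine eq_or_eq_of_ncard_eq_two hdeg (hadj a (by omega)).symm (hadj (a + 1) ha) ?_ hy
    intro h
    have := hinj _ _ (by omega) (by omega) h
    omega
  · have := hG.le_of_chord hadj hinj (a := 0) (b := m + 1) (by omega) le_rfl h.symm
    omega

/-- Otherwise the single edge would be a path between vertices of valence other than two, which
needs at least `k ≥ 2` edges. -/
theorem IsSufficientlySubdivided.ncard_neighbor_eq_two
    (hG : IsSufficientlySubdivided G (k + 1)) (hk : 2 ≤ k) {v i : V}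
    (hv : (G.neighborSet v).ncard ≠ 2) (hi : G.Adj v i) : (G.neighborSet i).ncard = 2 := by
  by_contra hne
  have := hG.1 _ _ (SimpleGraph.Walk.cons hi .nil) hi.ne hv hne (by simp [hi.ne])
  simp at this
  omega

/-- Removing a star with leaves of valence two from a graph without cut vertices leaves a
connected graph. -/
theorem reflTransGen_of_connected_erase [Fintype V] [DecidableEq V] {v : V} {L : Finset V}
    (hconn : (G.induce {w | w ∉ ({v} : Finset V)}).Preconnected)
    (hL : ∀ i ∈ L, G.Adj v i ∧ (G.neighborSet i).ncard = 2) {a b : V} (ha : a ∉ insert v L)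
    (hb : b ∉ insert v L) :
    Relation.ReflTransGen (fun a b => G.Adj a b ∧ a ∉ insert v L ∧ b ∉ insert v L) a b := by
  set R := fun a b => G.Adj a b ∧ a ∉ insert v L ∧ b ∉ insert v L with hR
  have hmem : ∀ {c}, Relation.ReflTransGen R a c → c ∉ insert v L := fun h => by
    rcases Relation.ReflTransGen.cases_tail h with rfl | ⟨_, _, h⟩
    · exact ha
    · exact h.2.2
  have hav : a ≠ v := fun h => ha (by simp [h])
  have hbv : b ≠ v := fun h => hb (by simp [h])
  have hreach := hconn ⟨a, by simpa using hav⟩ ⟨b, by simpa using hbv⟩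
  rw [SimpleGraph.reachable_iff_reflTransGen] at hreach
  -- Once `v` is removed, each leaf has a single neighbour left, so a walk that enters a leaf must
  -- return to where it came from. The second clause records that vertex as reachable.
  suffices ∀ c, Relation.ReflTransGen (G.induce {w | w ∉ ({v} : Finset V)}).Adj
      ⟨a, by simpa using hav⟩ c → (c.1 ∉ insert v L → Relation.ReflTransGen R a c.1) ∧
        (c.1 ∈ insert v L → ∀ d, d ≠ v → G.Adj c.1 d → Relation.ReflTransGen R a d) from
    (this _ hreach).1 hb
  intro c hc
  induction hc with
  | refl => exact ⟨fun _ => .refl, fun h => absurd h ha⟩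
  | @tail c d _ hcd ih =>
    have hcd' : G.Adj c.1 d.1 := hcd
    have hdv : d.1 ≠ v := by simpa using d.2
    have hcv : c.1 ≠ v := by simpa using c.2
    by_cases hc : c.1 ∈ insert v L
    · have h := ih.2 hc d.1 hdv hcd'
      exact ⟨fun _ => h, fun hd => absurd hd (hmem h)⟩
    · have h := ih.1 hc
      refine ⟨fun hd => h.tail ⟨hcd', hc, hd⟩, fun hd e hev hde => ?_⟩
      obtain ⟨hvd, hdeg⟩ := hL d.1 ((Finset.mem_insert.1 hd).resolve_left hdv)
      rcases eq_or_eq_of_ncard_eq_two hdeg hvd.symm hcd'.symm (Ne.symm hcv) hde with rfl | rfl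
      · exact absurd rfl hev
      · exact h

/-- On a sufficiently subdivided 2-connected graph the flux through an exchange on a star does
not depend on the positions of the other particles. -/
theorem IsClosedOn.starFlux_eq {A : Type*} [AddCommGroup A] [Fintype V] [DecidableEq V]
    {F : Finset V → V → V → A} (hF : IsClosedOn G Finset.univ (k + 1) F) (hk : 2 ≤ k)
    (hconn : IsKConnected 2 G) (hG : IsSufficientlySubdivided G (k + 1)) {v i j l : V}
    (hi : G.Adj v i) (hj : G.Adj v j) (hl : G.Adj v l) (hij : i ≠ j) (hjl : j ≠ l) (hil : i ≠ l)
    {M M' : Finset V} (hvM : v ∉ M) (hiM : i ∉ M) (hjM : j ∉ M) (hlM : l ∉ M) (hvM' : v ∉ M')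
    (hiM' : i ∉ M') (hjM' : j ∉ M') (hlM' : l ∉ M') (hM : M.card + 2 = k + 1)
    (hM' : M'.card + 2 = k + 1) : starFlux F M v i j l = starFlux F M' v i j l := by
  have hv := ncard_neighborSet_ne_two hi hj hl hij hjl hil
  set L : Finset V := {i, j, l} with hL
  have hmem : ∀ {w}, w ∈ Finset.univ \ insert v L ↔ w ≠ v ∧ w ≠ i ∧ w ≠ j ∧ w ≠ l := by
    simp [hL]
  have hsub : ∀ {X : Finset V}, v ∉ X → i ∉ X → j ∉ X → l ∉ X → X ⊆ Finset.univ \ insert v L :=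
    fun h1 h2 h3 h4 w hw => hmem.2 ⟨fun h => h1 (h ▸ hw), fun h => h2 (h ▸ hw),
      fun h => h3 (h ▸ hw), fun h => h4 (h ▸ hw)⟩
  refine eq_of_card_eq (U := Finset.univ \ insert v L) (m := k - 2)
    (g := fun M => starFlux F M v i j l)
    (R := fun a b => G.Adj a b ∧ a ∉ insert v L ∧ b ∉ insert v L) ?_ ?_
    (hsub hvM hiM hjM hlM) (hsub hvM' hiM' hjM' hlM') (by omega) (by omega)
  · rintro a b ⟨hab, ha, hb⟩
    have haU : a ∈ Finset.univ \ insert v L := by simpa using ha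
    have hbU : b ∈ Finset.univ \ insert v L := by simpa using hb
    refine ⟨hab.ne, haU, hbU, fun X hX hXc haX hbX => ?_⟩
    obtain ⟨hav, hai, haj, hal⟩ := hmem.1 haU
    obtain ⟨hbv, hbi, hbj, hbl⟩ := hmem.1 hbU
    have hX' : ∀ {w}, w ∈ insert v L → w ∉ X := fun hw h => by
      have := hX h
      rw [Finset.mem_sdiff] at this
      exact this.2 hw
    have hvX : v ∉ X := hX' (by simp)
    have hiX : i ∉ X := hX' (by simp [hL])
    have hjX : j ∉ X := hX' (by simp [hL])
    have hlX : l ∉ X := hX' (by simp [hL])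
    -- A spectator step `a → b` off the star forms a square with each of the six moves of the
    -- exchange. Around the closed exchange the values on `a → b` cancel.
    have hsq : ∀ q c d, q ∉ X → c ∉ X → d ∉ X → G.Adj c d → q ≠ c → q ≠ d → a ≠ c → a ≠ d →
        a ≠ q → b ≠ c → b ≠ d → b ≠ q →
        F (insert q (insert a X)) c d + F (insert q (insert d X)) a b =
          F (insert q (insert b X)) c d + F (insert q (insert c X)) a b := by
      intro q c d hq hc hd hcd hqc hqd hac had haq hbc hbd hbq
      have := hF.square (insert q X) a b c d (Finset.subset_univ _) (Finset.mem_univ _)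
        (Finset.mem_univ _) (Finset.mem_univ _) (Finset.mem_univ _) hab hcd hac had hbc hbd
        (by simp [haq, haX]) (by simp [hbq, hbX]) (by simp [hqc.symm, hc])
        (by simp [hqd.symm, hd]) (by rw [Finset.card_insert_of_notMem hq]; omega)
      simpa only [Finset.insert_comm _ q] using this
    have e1 := hsq i j v hiX hjX hvX hj.symm hij hi.ne' haj hav hai hbj hbv hbi
    have e2 := hsq i v l hiX hvX hlX hl hi.ne' hil hav hal hai hbv hbl hbi
    have e3 := hsq l i v hlX hiX hvX hi.symm hil.symm hl.ne' hai hav hal hbi hbv hbl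
    have e4 := hsq l v j hlX hvX hjX hj hl.ne' hjl.symm hav haj hal hbv hbj hbl
    have e5 := hsq j l v hjX hlX hvX hl.symm hjl hj.ne' hal hav haj hbl hbv hbj
    have e6 := hsq j v i hjX hvX hiX hi hj.ne' hij.symm hav hai haj hbv hbi hbj
    simp only [Finset.insert_comm l i, Finset.insert_comm l j, Finset.insert_comm j i] at *
    simp only [starFlux]
    linear_combination (norm := abel) e1 + e2 + e3 + e4 + e5 + e6
  · intro a ha b hb
    refine reflTransGen_of_connected_erase (hconn.2 {v} (by simp)).preconnected (fun w hw => ?_)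
      (Finset.mem_sdiff.1 ha).2 (Finset.mem_sdiff.1 hb).2
    simp only [hL, Finset.mem_insert, Finset.mem_singleton] at hw
    rcases hw with rfl | rfl | rfl
    · exact ⟨hi, hG.ncard_neighbor_eq_two hk hv hi⟩
    · exact ⟨hj, hG.ncard_neighbor_eq_two hk hv hj⟩
    · exact ⟨hl, hG.ncard_neighbor_eq_two hk hv hl⟩

end GraphConf

/-! ### Decomposition of closed cochains, and fluxes through squares -/

namespace GraphConf

variable {V : Type*} {A : Type*} [AddCommGroup A] {G : SimpleGraph V} {n : ℕ}

theorem IsKConnected.connected [Fintype V] {k : ℕ} (hG : IsKConnected k G) (hk : 0 < k) :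
    G.Connected := by
  have h := hG.2 ∅ (by simpa using hk)
  obtain ⟨v⟩ := h.nonempty
  have : Nonempty V := ⟨v.1⟩
  refine ⟨fun a b => ?_⟩
  exact (h.preconnected ⟨a, by simp⟩ ⟨b, by simp⟩).map
    (SimpleGraph.Embedding.induce {v | v ∉ (∅ : Finset V)}).toHom

section Raw

variable [DecidableEq V] [Fintype V] {F : Finset V → V → V → A}

theorem isCohomologousOn_add_pairSum (hG : G.Connected) (hF : IsClosedOn G Finset.univ n F)
    {T : V → V → V → A} (hT : IsClosedPair G T)
    (hstar : ∀ v i j k : V, G.Adj v i → G.Adj v j → G.Adj v k → i ≠ j → j ≠ k → i ≠ k →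
      ∀ M : Finset V, v ∉ M → i ∉ M → j ∉ M → k ∉ M → M.card + 2 = n →
        starFlux F M v i j k = pairStarFlux T v i j k) :
    ∃ (α : V → V → A) (f : Finset V → A), (∀ a b, α b a = -α a b) ∧
      IsCohomologousOn G Finset.univ n (F - pairSum T) α f := by
  have hP := hT.isClosedOn_pairSum n
  refine (growsTo_univ hG).exists_isCohomologousOn n _ ⟨fun X u w => ?_, ?_⟩ ?_
  · simp only [Pi.sub_apply, hF.antisymm X u w, hP.antisymm X u w]
    abel
  · intro X i k j l hX hi hk hj hl hik hjl h1 h2 h3 h4 h5 h6 h7 h8 hc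
    have e1 := hF.square X i k j l hX hi hk hj hl hik hjl h1 h2 h3 h4 h5 h6 h7 h8 hc
    have e2 := hP.square X i k j l hX hi hk hj hl hik hjl h1 h2 h3 h4 h5 h6 h7 h8 hc
    simp only [Pi.sub_apply]
    linear_combination (norm := abel) e1 - e2
  · intro M v i j k _ _ _ _ _ hi hj hk hij hjk hik hvM hiM hjM hkM hc
    have e1 := hstar v i j k hi hj hk hij hjk hik M hvM hiM hjM hkM hc
    have e2 := starFlux_pairSum hT.antisymm (v := v) hiM hjM hkM
    rw [← e2] at e1
    simp only [starFlux, Pi.sub_apply] at e1 ⊢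
    linear_combination (norm := abel) e1

/-- On a sufficiently subdivided 2-connected graph every closed `n`-particle cochain is, up to
a coboundary, the sum of a one-particle potential and of two-particle interactions. -/
theorem IsClosedOn.exists_pairSum (hF : IsClosedOn G Finset.univ n F)
    (hconn : IsKConnected 2 G) (hG : IsSufficientlySubdivided G n) :
    ∃ T : V → V → V → A, IsClosedPair G T ∧
      ∃ (α : V → V → A) (f : Finset V → A), (∀ a b, α b a = -α a b) ∧
        IsCohomologousOn G Finset.univ n (F - pairSum T) α f := by
  have hzero : IsClosedPair G (0 : V → V → V → A) := ⟨by simp, by simp⟩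
  have hGc := hconn.connected (by omega)
  -- Fewer than two particles have no exchanges, so `T = 0` serves. For two particles `F` is itself
  -- a pair cochain.
  obtain _ | _ | _ | m := n
  · exact ⟨0, hzero, isCohomologousOn_add_pairSum hGc hF hzero
      fun v i j k _ _ _ _ _ _ M _ _ _ _ hM => by omega⟩
  · exact ⟨0, hzero, isCohomologousOn_add_pairSum hGc hF hzero
      fun v i j k _ _ _ _ _ _ M _ _ _ _ hM => by omega⟩
  · have hT : IsClosedPair G (fun p => F {p}) := by
      refine ⟨fun p => hF.antisymm {p}, fun i k j l hik hjl h1 h2 h3 h4 => ?_⟩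
      simpa using hF.square ∅ i k j l (Finset.subset_univ _) (Finset.mem_univ _)
        (Finset.mem_univ _) (Finset.mem_univ _) (Finset.mem_univ _) hik hjl h1 h2 h3 h4
        (by simp) (by simp) (by simp) (by simp) (by simp)
    refine ⟨_, hT, isCohomologousOn_add_pairSum hGc hF hT
      fun v i j k _ _ _ _ _ _ M _ _ _ _ hM => ?_⟩
    rw [Finset.card_eq_zero.1 (by omega : M.card = 0), starFlux, pairStarFlux]
    simp
  have hk : 2 ≤ m + 2 := by omega
  -- Without a vertex with three neighbours there are no stars and `T = 0` serves; with one, a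
  -- parking path can start there.
  by_cases hex : ∃ v i j k, G.Adj v i ∧ G.Adj v j ∧ G.Adj v k ∧ i ≠ j ∧ j ≠ k ∧ i ≠ k
  · obtain ⟨v, i, j, k, hi, hj, hk', hij, hjk, hik⟩ := hex
    obtain ⟨x, hx⟩ := hG.exists_isParkingPath hk
      (ncard_neighborSet_ne_two hi hj hk' hij hjk hik) hi
    obtain ⟨f, hf⟩ := exists_slideFlux_eq_zero hx (by omega) F
    have hF' := hF.gauge f
    have hT := isClosedPair_parkedPair hx hk hF' hf
    refine ⟨_, hT, isCohomologousOn_add_pairSum hGc hF hT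
      fun v i j k hi hj hk' hij hjk hik M hvM hiM hjM hkM hM => ?_⟩
    rw [pairStarFlux_parkedPair hx hk hF' hf ?_ hi hj hk' hij hjk hik hvM hiM hjM hkM hM,
      starFlux_gauge]
    intro v i j k hi hj hk' hij hjk hik M M' h1 h2 h3 h4 h5 h6 h7 h8 hM hM'
    exact hF'.starFlux_eq hk hconn hG hi hj hk' hij hjk hik h1 h2 h3 h4 h5 h6 h7 h8 hM hM'
  · exact ⟨0, hzero, isCohomologousOn_add_pairSum hGc hF hzero
      fun v i j k hi hj hk' hij hjk hik M _ _ _ _ _ =>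
        absurd ⟨v, i, j, k, hi, hj, hk', hij, hjk, hik⟩ hex⟩

end Raw

section Flux

variable [DecidableEq V]

@[simp]
theorem flux_nil (Ω : GaugePotential G n A) (S : Config G n) :
    flux Ω (Quiver.Path.nil : Quiver.Path S S) = 0 :=
  Quiver.Path.addWeight_nil _ S

@[simp]
theorem flux_cons (Ω : GaugePotential G n A) {S T U : Config G n} (p : Quiver.Path S T)
    (a : T ⟶ U) : flux Ω (p.cons a) = flux Ω p + Ω.1 a.1 :=
  Quiver.Path.addWeight_cons _ p a

theorem flux_comp (Ω : GaugePotential G n A) {S T U : Config G n} (p : Quiver.Path S T)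
    (q : Quiver.Path T U) : flux Ω (p.comp q) = flux Ω p + flux Ω q :=
  Quiver.Path.addWeight_comp _ p q

theorem flux_boundary (Ω : GaugePotential G n A) (c : Square G n) :
    flux Ω c.boundary = Ω.1 c.side₁ + Ω.1 c.side₂ + Ω.1 c.side₃ + Ω.1 c.side₄ := by
  rw [Square.boundary, flux_cons, flux_cons, flux_cons, flux_cons, flux_nil, zero_add]
  rfl

/-- A gauge potential is topological if and only if its flux through every `2`-cell vanishes. -/
theorem isTopological_iff (Ω : GaugePotential G n A) :
    IsTopological Ω ↔
      ∀ c : Square G n, Ω.1 c.side₁ + Ω.1 c.side₂ + Ω.1 c.side₃ + Ω.1 c.side₄ = 0 := by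
  refine ⟨fun h c => (flux_boundary Ω c).symm.trans (h _ _ (.square c)), fun h => ?_⟩
  have key : ∀ {S T : Config G n} {p q : Quiver.Path S T}, PathHomotopic p q →
      flux Ω p = flux Ω q := by
    intro S T p q hpq
    induction hpq with
    | refl p => rfl
    | symm _ ih => exact ih.symm
    | trans _ _ ih₁ ih₂ => exact ih₁.trans ih₂
    | comp _ _ ih₁ ih₂ => rw [flux_comp, flux_comp, ih₁, ih₂]
    | backtrack a =>
      have : Ω.1 (homReverse a).1 = -Ω.1 a.1 := Ω.2 a.1
      rw [flux_cons, flux_cons, flux_nil, this]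
      abel
    | square c => rw [flux_boundary, h c, flux_nil]
  exact fun S C hC => (key hC).trans (flux_nil Ω S)

theorem IsTopological.add {Ω Ω' : GaugePotential G n A} (h : IsTopological Ω)
    (h' : IsTopological Ω') : IsTopological (Ω + Ω') := by
  rw [isTopological_iff] at *
  intro c
  have e : ∀ s, (Ω + Ω').1 s = Ω.1 s + Ω'.1 s := fun _ => rfl
  simp only [e]
  linear_combination (norm := abel) h c + h' c

theorem IsTopological.neg {Ω : GaugePotential G n A} (h : IsTopological Ω) :
    IsTopological (-Ω) := by
  rw [isTopological_iff] at *
  intro c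
  have e : ∀ s, (-Ω).1 s = -Ω.1 s := fun _ => rfl
  simp only [e]
  linear_combination (norm := abel) -h c

/-- Opposite sides of a square are the same edge of the graph in opposite directions. -/
theorem isTopological_pureAB (ω : GaugePotential G 1 A) : IsTopological (pureAB ω) := by
  rw [isTopological_iff]
  intro c
  have h₁ : (pureAB ω).1 c.side₃ = -(pureAB ω).1 c.side₁ := ω.2 c.side₁.single
  have h₂ : (pureAB ω).1 c.side₄ = -(pureAB ω).1 c.side₂ := ω.2 c.side₂.single
  rw [h₁, h₂]
  abel

theorem equivalent_of_eq_add_coboundary {Ω Ω' : GaugePotential G n A} (f : Finset V → A)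
    (h : ∀ e, Ω.1 e = Ω'.1 e + f e.target.verts - f e.source.verts) : Equivalent Ω Ω' := by
  have key : ∀ {S T : Config G n} (p : Quiver.Path S T),
      flux Ω p = flux Ω' p + f T.verts - f S.verts := by
    intro S T p
    induction p with
    | nil => simp
    | cons p a ih =>
      obtain ⟨e, rfl, rfl⟩ := a
      rw [flux_cons, flux_cons, ih, h e]
      abel
  intro S C
  rw [key C]
  abel

/-- The values of a gauge potential as a function of all triples `(X, u, w)`, zero where
`{X, u → w}` is not a `1`-cell. -/
noncomputable def toCochain (Ω : GaugePotential G n A) (X : Finset V) (u w : V) : A :=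
  open Classical in
  if h : G.Adj u w ∧ u ∉ X ∧ w ∉ X ∧ X.card + 1 = n then
    Ω.1 ⟨X, u, w, h.1, h.2.1, h.2.2.1, h.2.2.2⟩ else 0

theorem toCochain_apply (Ω : GaugePotential G n A) (e : Move G n) :
    toCochain Ω e.stay e.src e.tgt = Ω.1 e :=
  dif_pos ⟨e.adj, e.src_notMem, e.tgt_notMem, e.card_stay⟩

theorem toCochain_antisymm (Ω : GaugePotential G n A) (X : Finset V) (u w : V) :
    toCochain Ω X w u = -toCochain Ω X u w := by
  by_cases h : G.Adj u w ∧ u ∉ X ∧ w ∉ X ∧ X.card + 1 = n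
  · rw [toCochain, toCochain, dif_pos h, dif_pos ⟨h.1.symm, h.2.2.1, h.2.1, h.2.2.2⟩]
    exact Ω.2 ⟨X, u, w, h.1, h.2.1, h.2.2.1, h.2.2.2⟩
  · rw [toCochain, toCochain, dif_neg h, dif_neg (fun h' =>
      h ⟨h'.1.symm, h'.2.2.1, h'.2.1, h'.2.2.2⟩), neg_zero]

theorem IsTopological.isClosedOn_toCochain [Fintype V] {Ω : GaugePotential G n A}
    (h : IsTopological Ω) : IsClosedOn G Finset.univ n (toCochain Ω) where
  antisymm := toCochain_antisymm Ω
  square X i k j l _ _ _ _ _ hik hjl hij hil hkj hkl hi hk hj hl hc := by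
    have := (isTopological_iff Ω).1 h 
      ⟨X, i, k, j, l, hik, hjl, hij, hil, hkj, hkl, hi, hk, hj, hl, hc⟩
    simp only [← toCochain_apply, Square.side₁, Square.side₂, Square.side₃, Square.side₄] at this
    rw [toCochain_antisymm Ω _ j l, toCochain_antisymm Ω _ i k] at this
    linear_combination (norm := abel) this

end Flux

end GraphConf

/-! ### Back to gauge potentials: real lifts, averaging and splittings -/

namespace GraphConf

variable {V : Type*} {A : Type*} [AddCommGroup A] {G : SimpleGraph V} {n : ℕ}

theorem Move.single_eq_self (e : Move G 1) : e.single = e := by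
  have : e.stay = ∅ := Finset.card_eq_zero.1 (by have := e.card_stay; omega)
  exact Move.ext this.symm rfl rfl

/-- The one-particle gauge potential with given values on directed edges. -/
def onePotential (α : V → V → A) (hα : ∀ a b, α b a = -α a b) : GaugePotential G 1 A :=
  ⟨fun e => α e.src e.tgt, fun e => hα e.src e.tgt⟩

/-- The two-particle gauge potential with given values on `{p, i → j}`. -/
def pairPotential (T : V → V → V → A) (hT : ∀ p i j, T p j i = -T p i j) :
    GaugePotential G 2 A :=
  ⟨fun e => pairSum T e.stay e.src e.tgt, fun e => by
    change pairSum T e.stay e.tgt e.src = _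
    simp only [pairSum, hT _ e.src e.tgt, Finset.sum_neg_distrib]⟩

theorem IsClosedPair.isTopological_pairPotential [DecidableEq V] {T : V → V → V → A}
    (hT : IsClosedPair G T) :
    IsTopological (pairPotential T hT.antisymm : GaugePotential G 2 A) := by
  rw [isTopological_iff]
  intro c
  have hc : c.stay = ∅ := Finset.card_eq_zero.1 (by have := c.card_stay; omega)
  have h := hT.square c.i c.k c.j c.l c.adj_ik c.adj_jl c.ne_ij c.ne_il c.ne_kj c.ne_kl
  simp only [pairPotential, pairSum, Square.side₁, Square.side₂, Square.side₃, Square.side₄, hc,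
    insert_empty_eq, Finset.sum_singleton]
  rw [hT.antisymm c.k c.j c.l, hT.antisymm c.j c.i c.k]
  linear_combination (norm := abel) h

theorem nParticle_pairPotential {T : V → V → V → A} (hT : ∀ p i j, T p j i = -T p i j)
    (ω : GaugePotential G 1 A) (e : Move G n) :
    (nParticle n ω (pairPotential T hT)).1 e =
      ω.1 e.single + pairSum T e.stay e.src e.tgt := by
  refine congrArg (ω.1 e.single + ·) ?_
  rw [pairSum, ← Finset.sum_attach e.stay, Finset.univ_eq_attach]
  refine Finset.sum_congr rfl fun v _ => ?_
  exact Finset.sum_singleton _ _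

theorem isTopological_nParticle [DecidableEq V] (ω : GaugePotential G 1 A)
    {S : GaugePotential G 2 A} (hS : IsTopological S) : IsTopological (nParticle n ω S) := by
  have hT : ∀ p i j, toCochain S {p} j i = -toCochain S {p} i j :=
    fun p => toCochain_antisymm S {p}
  have hST : S = pairPotential (fun p => toCochain S {p}) hT := by
    ext e
    obtain ⟨p, hp⟩ := Finset.card_eq_one.1 (by have := e.card_stay; omega : e.stay.card = 1)
    rw [← toCochain_apply S e]
    simp only [pairPotential, pairSum, hp, Finset.sum_singleton]
  rw [hST, isTopological_iff]
  intro c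
  -- The square of the two moving particles alone; everything else cancels between opposite sides.
  have h₂ := (isTopological_iff S).1 hS ⟨∅, c.i, c.k, c.j, c.l, c.adj_ik, c.adj_jl, c.ne_ij,
    c.ne_il, c.ne_kj, c.ne_kl, by simp, by simp, by simp, by simp, rfl⟩
  simp only [← toCochain_apply, Square.side₁, Square.side₂, Square.side₃, Square.side₄,
    insert_empty_eq] at h₂
  have hω₁ : ω.1 c.side₃.single = -ω.1 c.side₁.single := ω.2 c.side₁.single
  have hω₂ : ω.1 c.side₄.single = -ω.1 c.side₂.single := ω.2 c.side₂.single
  have hP : ∀ a b, pairSum (fun p => toCochain S {p}) c.stay a b =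
      -pairSum (fun p => toCochain S {p}) c.stay b a := fun a b => by
    simp only [pairSum, hT _ b a, Finset.sum_neg_distrib]
  simp only [nParticle_pairPotential, hω₁, hω₂]
  have e : ∀ q a b, q ∉ c.stay → pairSum (fun p => toCochain S {p}) (insert q c.stay) a b =
      toCochain S {q} a b + pairSum (fun p => toCochain S {p}) c.stay a b :=
    fun q a b hq => Finset.sum_insert hq
  simp only [Square.side₁, Square.side₂, Square.side₃, Square.side₄, e _ _ _ c.i_notMem,
    e _ _ _ c.j_notMem, e _ _ _ c.k_notMem, e _ _ _ c.l_notMem]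
  rw [hP c.l c.j, hP c.k c.i]
  linear_combination (norm := abel) h₂

theorem isTopological_of_isSplitting [DecidableEq V] [Fintype V] {Ω S : GaugePotential G 2 A}
    {ω : GaugePotential G 1 A} (hΩ : IsTopological Ω) (h : IsSplitting Ω ω S) :
    IsTopological S := by
  have : S = Ω + -pureAB ω := by rw [h.eq_add]; abel
  rw [this]
  exact hΩ.add (isTopological_pureAB ω).neg

section Lift

/-- Every gauge potential is the reduction of an antisymmetric real-valued function. -/
theorem exists_modTwoPi_eq [Fintype V] (Ω : GaugePotential G n Real.Angle) :
    ∃ R : GaugePotential G n ℝ, modTwoPi R = Ω := by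
  classical
  let idx := Fintype.equivFin V
  -- `Real.Angle.toReal` is not odd at `π`, so it is applied in one direction of each edge only,
  -- chosen by numbering the vertices.
  refine ⟨⟨fun e => if idx e.src < idx e.tgt then (Ω.1 e).toReal else -(Ω.1 e.reverse).toReal,
    fun e => ?_⟩, ?_⟩
  · change (if idx e.tgt < idx e.src then (Ω.1 e.reverse).toReal else -(Ω.1 e).toReal) =
      -(if idx e.src < idx e.tgt then (Ω.1 e).toReal else -(Ω.1 e.reverse).toReal)
    rcases lt_or_gt_of_ne (idx.injective.ne e.adj.ne) with h | h
    · rw [if_neg h.not_gt, if_pos h]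
    · rw [if_pos h, if_neg h.not_gt, neg_neg]
  · ext e
    change ((if idx e.src < idx e.tgt then (Ω.1 e).toReal
      else -(Ω.1 e.reverse).toReal : ℝ) : Real.Angle) = Ω.1 e
    split_ifs
    · exact Real.Angle.coe_toReal _
    · rw [Real.Angle.coe_neg, Real.Angle.coe_toReal, Ω.2 e, neg_neg]

theorem modTwoPi_pureAB (ω : GaugePotential G 1 ℝ) :
    modTwoPi (pureAB ω) = pureAB (modTwoPi ω) := rfl

theorem modTwoPi_add (R R' : GaugePotential G n ℝ) :
    modTwoPi (R + R') = modTwoPi R + modTwoPi R' := by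
  ext e
  exact Real.Angle.coe_add _ _

theorem coe_sum_angle {ι : Type*} (s : Finset ι) (f : ι → ℝ) :
    ((∑ i ∈ s, f i : ℝ) : Real.Angle) = ∑ i ∈ s, (f i : Real.Angle) :=
  map_sum Real.Angle.coeHom f s

theorem modTwoPi_nParticle (ω : GaugePotential G 1 ℝ) (S : GaugePotential G 2 ℝ) :
    modTwoPi (nParticle n ω S) = nParticle n (modTwoPi ω) (modTwoPi S) := by
  ext e
  refine (Real.Angle.coe_add _ _).trans ?_
  rw [coe_sum_angle]
  rfl

end Lift

section Average

variable [Fintype V] [DecidableEq V]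

theorem card_ne_and_ne {a b : V} (hab : a ≠ b) :
    Fintype.card {p : V // p ≠ a ∧ p ≠ b} + 2 = Fintype.card V := by
  have h : (Finset.univ.filter fun p : V => p ≠ a ∧ p ≠ b) = (Finset.univ.erase a).erase b := by
    ext p
    simp [and_comm]
  rw [Fintype.card_subtype, h]
  have h1 := Finset.card_erase_add_one (Finset.mem_univ a)
  have h2 := Finset.card_erase_add_one (s := Finset.univ.erase a) (a := b) (by simp [hab.symm])
  rw [Finset.card_univ] at h1
  omega

theorem isPureStatistics_statisticsPart (R : GaugePotential G 2 ℝ) :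
    IsPureStatistics (statisticsPart R) := by
  intro e
  have hs : ∀ p : {p : V // p ≠ e.src ∧ p ≠ e.tgt}, (statisticsPart R).1 (e.pair p.1 p.2.1 p.2.2) =
      R.1 (e.pair p.1 p.2.1 p.2.2) - (average R).1 e := fun p =>
    congrArg (R.1 (e.pair p.1 p.2.1 p.2.2) - (average R).1 ·) e.single_eq_self
  have hc := card_ne_and_ne e.adj.ne
  have hc' : ((Fintype.card {p : V // p ≠ e.src ∧ p ≠ e.tgt} : ℕ) : ℝ) =
      (Fintype.card V : ℝ) - 2 := by
    rw [← hc]; push_cast; ring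
  rw [Finset.sum_congr rfl fun p _ => hs p, Finset.sum_sub_distrib, Finset.sum_const,
    Finset.card_univ, nsmul_eq_mul, hc']
  -- If `|V| = 2` no spectator position exists and the sum is empty; otherwise the factor `|V| - 2`
  -- cancels.
  rcases Nat.eq_zero_or_pos (Fintype.card {p : V // p ≠ e.src ∧ p ≠ e.tgt}) with h0 | hpos
  · have := Fintype.card_eq_zero_iff.1 h0
    rw [← hc', h0]
    simp
  · have : (Fintype.card V : ℝ) - 2 ≠ 0 := by rw [← hc']; positivity
    change _ - ((Fintype.card V : ℝ) - 2) * (1 / ((Fintype.card V : ℝ) - 2) * _) = 0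
    field_simp
    ring

theorem isSplitting_modTwoPi (R : GaugePotential G 2 ℝ) :
    IsSplitting (modTwoPi R) (modTwoPi (average R)) (modTwoPi (statisticsPart R)) where
  eq_add := by
    rw [← modTwoPi_pureAB, ← modTwoPi_add, statisticsPart, add_sub_cancel]
  pureStatistics e := by
    have := congrArg (fun t : ℝ => (t : Real.Angle)) (isPureStatistics_statisticsPart R e)
    simp only [coe_sum_angle, Real.Angle.coe_zero] at this
    exact this

theorem average_pureAB_add (hV : 2 < Fintype.card V) (ω : GaugePotential G 1 ℝ)
    (R : GaugePotential G 2 ℝ) : average (pureAB ω + R) = ω + average R := by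
  ext e
  have hs : ∀ p : {p : V // p ≠ e.src ∧ p ≠ e.tgt},
      (pureAB ω + R).1 (e.pair p.1 p.2.1 p.2.2) =
        ω.1 e + R.1 (e.pair p.1 p.2.1 p.2.2) := fun p =>
    congrArg (ω.1 · + R.1 (e.pair p.1 p.2.1 p.2.2)) e.single_eq_self
  have hc := card_ne_and_ne e.adj.ne
  have hc' : ((Fintype.card {p : V // p ≠ e.src ∧ p ≠ e.tgt} : ℕ) : ℝ) =
      (Fintype.card V : ℝ) - 2 := by
    rw [← hc]; push_cast; ring
  have hne : (Fintype.card V : ℝ) - 2 ≠ 0 := by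
    have : (2 : ℝ) < Fintype.card V := by exact_mod_cast hV
    linarith
  change 1 / ((Fintype.card V : ℝ) - 2) * _ = ω.1 e + 1 / ((Fintype.card V : ℝ) - 2) * _
  rw [Finset.sum_congr rfl fun p _ => hs p, Finset.sum_add_distrib, Finset.sum_const,
    Finset.card_univ, nsmul_eq_mul, hc']
  field_simp

/-- A sum of a one-particle potential and of two-particle interactions comes from a splitting:
the averages of the interactions are absorbed in the one-particle potential. -/
theorem exists_nParticle_average_eq (hV : 2 < Fintype.card V) (ω : GaugePotential G 1 ℝ)
    (S : GaugePotential G 2 ℝ) :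
    ∃ ω' : GaugePotential G 1 ℝ, nParticle n (average (pureAB ω' + S))
      (statisticsPart (pureAB ω' + S)) = nParticle n ω S := by
  -- Passing to the statistics part subtracts the average of `S` once for each of the `n - 1`
  -- spectators, while `average (pureAB ω' + S)` contains it once; `ω'` supplies the missing `n -
  -- 2`.
  obtain ⟨ω', hω'⟩ : ∃ ω' : GaugePotential G 1 ℝ,
      ∀ e, ω'.1 e = ω.1 e + ((n : ℝ) - 2) * (average S).1 e :=
    ⟨⟨fun e => ω.1 e + ((n : ℝ) - 2) * (average S).1 e, fun e => by
      simp only [ω.2 e, (average S).2 e]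
      ring⟩, fun _ => rfl⟩
  refine ⟨ω', ?_⟩
  rw [statisticsPart, average_pureAB_add hV]
  ext e
  have hS : ∀ v : {v : V // v ∈ e.stay}, ∀ h h', (pureAB ω' + S - pureAB (ω' + average S)).1
      (e.pair v.1 h h') = S.1 (e.pair v.1 h h') - (average S).1 e.single := fun v h h' => by
    change ω'.1 e.single + S.1 _ - (ω'.1 e.single + (average S).1 e.single) = _
    ring
  change ω'.1 e.single + (average S).1 e.single + ∑ v : {v : V // v ∈ e.stay},
    (pureAB ω' + S - pureAB (ω' + average S)).1 (e.pair v.1 _ _) =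
      ω.1 e.single + ∑ v : {v : V // v ∈ e.stay}, S.1 (e.pair v.1 _ _)
  rw [Finset.sum_congr rfl fun v _ => hS v _ _, Finset.sum_sub_distrib, Finset.sum_const,
    Finset.card_univ, Fintype.card_coe, nsmul_eq_mul, hω']
  have hn : (n : ℝ) = e.stay.card + 1 := by exact_mod_cast e.card_stay.symm
  linear_combination (average S).1 e.single * hn

end Average

/-- The real lifts `ω` and `S` need not be closed: the averaging identity holds for all real
potentials, and closedness is used only after reduction modulo `2π`. -/
theorem exists_equivalent_nParticle [Fintype V] [DecidableEq V] (hconn : IsKConnected 2 G)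
    (hG : IsSufficientlySubdivided G n) {Ω : GaugePotential G n Real.Angle}
    (hΩ : IsTopological Ω) :
    ∃ R : GaugePotential G 2 ℝ, IsTopological (modTwoPi R) ∧
      Equivalent Ω (nParticle n (modTwoPi (average R)) (modTwoPi (statisticsPart R))) := by
  obtain ⟨T, hT, α, f, hα, h⟩ := hΩ.isClosedOn_toCochain.exists_pairSum hconn hG
  obtain ⟨ω, hω⟩ := exists_modTwoPi_eq (G := G) (onePotential α hα)
  obtain ⟨S, hS⟩ := exists_modTwoPi_eq (G := G) (pairPotential T hT.antisymm)
  obtain ⟨ω', hω'⟩ := exists_nParticle_average_eq (n := n) hconn.1 ω S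
  refine ⟨pureAB ω' + S, ?_, ?_⟩
  · rw [modTwoPi_add, modTwoPi_pureAB, hS]
    exact (isTopological_pureAB _).add hT.isTopological_pairPotential
  · rw [← modTwoPi_nParticle, hω', modTwoPi_nParticle, hω, hS]
    refine equivalent_of_eq_add_coboundary f fun e => ?_
    have he := h e.stay e.src e.tgt (Finset.subset_univ _) (Finset.mem_univ _)
      (Finset.mem_univ _) e.adj e.src_notMem e.tgt_notMem e.card_stay
    rw [Pi.sub_apply, Pi.sub_apply, Pi.sub_apply, toCochain_apply, sub_eq_iff_eq_add] at he
    rw [he, nParticle_pairPotential]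
    change _ = α e.src e.tgt + _ + f (insert e.tgt e.stay) - f (insert e.src e.stay)
    abel

end GraphConf

theorem mainTheorem9 {V : Type*} [Fintype V] [DecidableEq V] (G : SimpleGraph V)
    (n : ℕ) (hn : 1 ≤ n) :
    -- every two-particle gauge potential has a real representative, and averaging a real
    -- representative splits it into a pure Aharonov-Bohm and a pure statistics part
    (∀ Ω : GraphConf.GaugePotential G 2 Real.Angle,
      ∃ R : GraphConf.GaugePotential G 2 ℝ, GraphConf.modTwoPi R = Ω) ∧
    (∀ R : GraphConf.GaugePotential G 2 ℝ,
      GraphConf.IsSplitting (GraphConf.modTwoPi R)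
        (GraphConf.modTwoPi (GraphConf.average R))
        (GraphConf.modTwoPi (GraphConf.statisticsPart R))) ∧
    -- for every splitting of a topological potential both parts are topological, and so is the
    -- `n`-particle potential built from them
    (∀ (Ω : GraphConf.GaugePotential G 2 Real.Angle) (ω : GraphConf.GaugePotential G 1 Real.Angle)
      (S : GraphConf.GaugePotential G 2 Real.Angle),
      GraphConf.IsTopological Ω → GraphConf.IsSplitting Ω ω S →
        GraphConf.IsTopological (GraphConf.pureAB ω) ∧ GraphConf.IsTopological S ∧
          GraphConf.IsTopological (GraphConf.nParticle n ω S)) ∧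
    -- on a 2-connected graph every class of topological `n`-particle potentials arises so
    (GraphConf.IsKConnected 2 G → GraphConf.IsSufficientlySubdivided G n →
      ∀ Ω : GraphConf.GaugePotential G n Real.Angle, GraphConf.IsTopological Ω →
        ∃ R : GraphConf.GaugePotential G 2 ℝ, GraphConf.IsTopological (GraphConf.modTwoPi R) ∧
          GraphConf.Equivalent Ω
            (GraphConf.nParticle n (GraphConf.modTwoPi (GraphConf.average R))
              (GraphConf.modTwoPi (GraphConf.statisticsPart R)))) := by
  refine ⟨GraphConf.exists_modTwoPi_eq, GraphConf.isSplitting_modTwoPi,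
    fun Ω ω S hΩ h => ?_, fun hconn hG Ω hΩ =>
      GraphConf.exists_equivalent_nParticle hconn hG hΩ⟩
  have hS := GraphConf.isTopological_of_isSplitting hΩ h
  exact ⟨GraphConf.isTopological_pureAB ω, hS, GraphConf.isTopological_nParticle ω hS⟩
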